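/- **Corollary 2 (Order-tight Bound).** *Source.* Fix $\beta\in(0,1)$, put $k=k(n)=\lfloor n^{1-\beta}\rfloor$, and fix $U>0$, a norm index $q\in(0,\infty]$ and a precision of $Q\ge 1$ bits. For every $n$ let $X\in\mathbb R^n$ be a random vector with exactly $k$ non-zero entries, whose support is uniformly distributed over the $k$-subsets of $\{1,\dots,n\}$, and with $|X_i|\le U$; the non-zero values may have any joint law, also depending on the support and on $n$, provided their average magnitude does not vanish: for some constants $c_0,\gamma>0$ and $K$, $\Pr\big(\|X\|_{\ell_q}<c_0k^{1/q}U\big)\le K e^{-\gamma k}$ for all large $n$ (with $k^{1/\infty}=1$). *Circuit.* Let $\Lambda\subset\mathbb R^2$ be a lattice that spans $\mathbb R^2$, with packing radius at least $\rho>0$. A decoding circuit for $m$ measurements places $m$ input-nodes and $n$ output-nodes at distinct points of $\Lambda$ inside a compact set. The $i$-th input-node stores the $i$-th entry of $Y=AX\in\mathbb C^m$, where $A\in\mathbb C^{m\times n}$ is the encoding matrix. Over the unidirectional link from a node $u$ to another node $v$ one finite binary string (possibly empty, i.e. silence) is sent, at a time fixed in advance, and it is a (measurable) function of the number stored at $u$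 and of the strings that $u$ received before. After a fixed number of time steps the $j$-th output-node declares the entry $\hat X_j\in\mathbb R$ of the recovery vector as a function of the strings it received, and declares $0$ if it received no bit. If $\mathcal B(u,v)$ is the number of bits exchanged between $u$ and $v$ in both directions, which depends on $X$, the bit-meters are $\mu=\tfrac12\sum_{u,v}\mathcal B(u,v)\,\|u-v\|_2$. The average block error probability is $P_e=\Pr\big(\|X-\hat X\|_{\ell_q}/\|X\|_{\ell_q}>2^{-Q}\big)$. *Claim.* There is a constant $M_0>0$ such that for every $M_1$ there are constants $c,C,D>0$ with the following property. For every choice of $m=m(n)$ with $M_0k\le m\le M_1k$ for all large $n$, and for every sequence of sources as above, there are encoding matrices $A\in\mathbb C^{m\times n}$ and decoding circuits on $\Lambda$ such that for all large $n$ $$0<P_e\le \frac{D}{\sqrt k}\qquad\text{and}\qquad \mu=\Theta\!\left(\sqrt{\frac{nk}{\log n}}\sqrt{\log\frac1{P_e}}\right),$$ both on average and in the worst case: $\mathbb E[\mu]\ge c\sqrt{\tfrac{nk}{\log n}}\sqrt{\log\tfrac1{P_e}}$, and $\mu\le C\sqrt{\tfrac{nk}{\log n}}\sqrt{\log\tfrac1{P_e}}$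 for every input vector with exactly $k$ non-zero entries, all of absolute value at most $U$. The constants $M_0,M_1,c,C,D$ depend only on $\beta,U,q,Q,c_0,\gamma,K,\Lambda$ (and $c,C,D$ also on $M_1$), not on $n$, $m$ or the laws of the sources. -/

import Mathlib

open Filter MeasureTheory
open scoped Matrix ENNReal

noncomputable section

/-- The plane in which circuits are laid out, with its Euclidean distance. -/
abbrev Plane : Type := EuclideanSpace ℝ (Fin 2)

/-- The packing radius of a lattice: half the least norm of a nonzero lattice vector. -/
def packingRadius (Λ : Submodule ℤ Plane) : ℝ :=
  (⨅ v : {v : Plane // v ∈ Λ ∧ v ≠ 0}, ‖(v : Plane)‖) / 2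

/-! ### Sparse sources -/

/-- `x` has exactly `k` nonzero entries, all of absolute value at most `U`. -/
def IsSparseVector {n : ℕ} (k : ℕ) (U : ℝ) (x : Fin n → ℝ) : Prop :=
  {i | x i ≠ 0}.ncard = k ∧ ∀ i, |x i| ≤ U

/-- `P` is the law of a random `k`-sparse vector bounded by `U`, whose support is uniformly
distributed over the `k`-element subsets. The values on the support are arbitrary: they may have
any joint law and may depend on the support. -/
structure IsSparseSource {n : ℕ} (k : ℕ) (U : ℝ) (P : Measure (Fin n → ℝ)) : Prop where
  isProbabilityMeasure : IsProbabilityMeasure P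
  ae_sparse : ∀ᵐ x ∂P, IsSparseVector k U x
  uniform_support : ∀ S : Finset (Fin n), S.card = k →
    P {x | ∀ i, x i ≠ 0 ↔ i ∈ S} = ((n.choose k : ℕ) : ℝ≥0∞)⁻¹

/-- The `ℓ_q` size of a vector, `0 < q ≤ ∞` (for `q < 1` it is only a quasi-norm). -/
def lqNorm {n : ℕ} (q : ℝ≥0∞) (x : Fin n → ℝ) : ℝ := ‖WithLp.toLp q x‖

/-- The relative error of the recovery vector `x'` for the input vector `x`. -/
def relativeError {n : ℕ} (q : ℝ≥0∞) (x x' : Fin n → ℝ) : ℝ :=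
  lqNorm q (x - x') / lqNorm q x

/-- The output vector `A x ∈ ℂ^m` of the input vector `x ∈ ℝ^n`. -/
def measurement {m n : ℕ} (A : Matrix (Fin m) (Fin n) ℂ) (x : Fin n → ℝ) : Fin m → ℂ :=
  A *ᵥ fun j => (x j : ℂ)

/-! ### Decoding circuits -/

/-- The nodes of a circuit: `inl i` is the input-node storing the `i`-th measurement, `inr j` is
the output-node responsible for the `j`-th entry of the recovery vector. -/
abbrev Node (m n : ℕ) : Type := Fin m ⊕ Fin n

/-- A decoding circuit on the lattice `Λ` for `m` measurements and vectors of length `n`.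

The nodes sit at distinct lattice points of a compact substrate. For every ordered pair `(u, v)`
of distinct nodes there is a unidirectional link, which may carry one binary string, at the time
`slot u v`. That string depends only on the number stored at `u` and on the strings that have
reached `u` before; the empty string is silence. The times are fixed in advance, so that no
information is hidden in the time at which a string is sent. After `rounds` time steps the
output-nodes declare the entries of the recovery vector from the strings they received; one that
received nothing declares `0`. -/
structure DecodingCircuit (Λ : Submodule ℤ Plane) (m n : ℕ) where
  substrate : Set Plane
  isCompact_substrate : IsCompact substrate
  pos : Node m n → Plane
  pos_injective : Function.Injective pos
  pos_mem : ∀ u, pos u ∈ (Λ : Set Plane) ∩ substrate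
  rounds : ℕ
  slot : Node m n → Node m n → ℕ
  rule : Node m n → Node m n → ℂ → (Node m n → List Bool) → List Bool
  rule_self : ∀ u z h, rule u u z h = []
  measurableSet_rule : ∀ u v h w, MeasurableSet {z | rule u v z h = w}
  out : Fin n → (Node m n → List Bool) → ℝ
  out_silent : ∀ j, out j (fun _ => []) = 0

namespace DecodingCircuit

variable {Λ : Submodule ℤ Plane} {m n : ℕ} (ckt : DecodingCircuit Λ m n)

/-- The number stored at a node at the start; the output-nodes know nothing about `y`. -/
def stored (y : Fin m → ℂ) : Node m n → ℂ := Sum.elim y fun _ => 0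

/-- `traffic y t u v` is the string sent from `u` to `v` before time `t`, when the input-nodes
store `y`. -/
def traffic (y : Fin m → ℂ) : ℕ → Node m n → Node m n → List Bool
  | 0 => fun _ _ => []
  | t + 1 => fun u v =>
      if ckt.slot u v = t then ckt.rule u v (stored y u) (fun w => traffic y t w u)
      else traffic y t u v

/-- The string sent from `u` to `v` during the whole computation. -/
def message (y : Fin m → ℂ) (u v : Node m n) : List Bool := ckt.traffic y ckt.rounds u v

/-- The recovery vector that the circuit declares. -/
def recover (y : Fin m → ℂ) : Fin n → ℝ :=
  fun j => ckt.out j fun w => ckt.message y w (Sum.inr j)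

/-- The number of bits communicated between `u` and `v`, in both directions. -/
def bits (y : Fin m → ℂ) (u v : Node m n) : ℕ :=
  (ckt.message y u v).length + (ckt.message y v u).length

/-- The bit-meters of a collection of nodes. -/
def bitMetersOn (y : Fin m → ℂ) (E : Finset (Node m n)) : ℝ :=
  ∑ u ∈ E, ∑ v ∈ E, (ckt.bits y u v : ℝ) * dist (ckt.pos u) (ckt.pos v) / 2

/-- The bit-meters of the circuit, when the input-nodes store `y`. -/
def bitMeters (y : Fin m → ℂ) : ℝ := ckt.bitMetersOn y Finset.univ

/-- The average block error probability, at a precision of `Q` bits in `ℓ_q`, of the circuit with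
the encoding matrix `A` on a source with law `P`. -/
def errorProb (A : Matrix (Fin m) (Fin n) ℂ) (q : ℝ≥0∞) (Q : ℕ) (P : Measure (Fin n → ℝ)) : ℝ :=
  P.real {x | ((2 : ℝ) ^ Q)⁻¹ < relativeError q x (ckt.recover (measurement A x))}

end DecodingCircuit

/-- The sparsity `k = n^(1-β)`, rounded down to an integer. -/
def sparsity (β : ℝ) (n : ℕ) : ℕ := ⌊(n : ℝ) ^ (1 - β)⌋₊

/-- The order `√(n k / log n) · √(log (1 / Pe))`. -/
def tightOrder (n k : ℕ) (Pe : ℝ) : ℝ :=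
  √((n : ℝ) * k / Real.log n) * √(Real.log (1 / Pe))

end

/-! Everything rests on one two-level decoder. Put `l = Nat.log 2 n` and `g = k / l`, and split the
indices into `g` blocks of about `n / g` entries, so that a block holds about `l` non-zero entries
on average. Each block occupies a square cell of side about `√(n / g)`, with a centre and `O(l)`
probes that measure this block alone; a central hub has `O(k)` sensors at distance `O(√k)` that
measure the whole vector. Every measurement is reported with `O(l)` bits. A counting argument
(`exists_robust_matrix`) gives integer matrices with `8 s + 1` rows that separate `s`-sparse vectors
up to a polynomial factor in `n`, which is why `O(l)` bits suffice.

A centre decodes its block if the block holds at most `48 l` detected entries. The hub serves the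
entries of the other blocks directly, over distances of order `√n`, and sends one bit to every
centre that has to speak. By `card_overload_mul_le` the crowded blocks contain `g` or more support
elements with probability at most `2 ^ (-g)`; in that case the decoder gives up. Hence `Pe ≤ 4 * 2 ^
(-g)`, so that `log (1 / Pe)` is at least of order `k / l` and `tightOrder` is at least of order `X
= k √n / l` (`Regime.tightOrder_ge`). The long links carry `O(g)` bits and cost `O(g √n) = O(X)`;
the cells cost `O(l ^ 2 √(g n))` and the cluster of the hub `O(l k √k)`, both at most of order `X`
because `l ^ 6 ≤ k` and `l ^ 4 k ≤ n` (`Regime.cost_le`). A smaller error probability only relaxes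
the upper bound, so no lower estimate of `Pe` beyond positivity is needed.

Two devices supply the rest. The number stored at the hub is a linear form that vanishes on one
coordinate subspace of dimension `k`; the circuit declares `0` whenever this number is `0`, which
forces `Pe > 0` (`exists_test_form`, `errorProb_pos`). The lower bound on the bit-meters comes from
padding: the hub sends meaningless bits to a sensor until the bit-meters reach `tightOrder`. No
output depends on these bits, so `Pe` is unaffected (`errorProb_pad`). -/

/-! ### Integer matrices that are well conditioned on sparse vectors -/

theorem card_mul_le_of_unique_coord {n R : ℕ} (B : Finset (Fin n → Fin R)) (j₀ : Fin n)
    (h : ∀ a ∈ B, ∀ b ∈ B, (∀ j, j ≠ j₀ → a j = b j) → a = b) :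
    B.card * R ≤ R ^ n := by
  have hc : (B ×ˢ (Finset.univ : Finset (Fin R))).card
      ≤ (Finset.univ : Finset (Fin n → Fin R)).card := by
    -- Overwriting coordinate `j₀` loses nothing, since the other coordinates already determine the
    -- member of `B`.
    refine Finset.card_le_card_of_injOn (fun p => Function.update p.1 j₀ p.2)
      (fun _ _ => Finset.mem_coe.2 (Finset.mem_univ _)) ?_
    rintro ⟨a, r⟩ ha ⟨b, r'⟩ hb hab
    simp only [Finset.coe_product, Set.mem_prod, Finset.mem_coe] at ha hb
    have hab' : ∀ j, Function.update a j₀ r j = Function.update b j₀ r' j := fun j =>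
      congrFun hab j
    have h1 : a = b := h a ha.1 b hb.1 fun j hj => by
      have := hab' j
      rwa [Function.update_of_ne hj, Function.update_of_ne hj] at this
    have h2 : r = r' := by simpa using hab' j₀
    rw [h1, h2]
  simpa [Finset.card_product] using hc

/-- With the other coefficients fixed, two admissible values of `a j₀` would produce sums that
differ by a non-zero multiple of `W j₀` and by less than `2 * E`. So a uniformly chosen row fails
with probability at most `1 / R`. -/
theorem card_rows_mul_le {n R : ℕ} (W : Fin n → ℤ) (j₀ : Fin n) (E : ℤ)
    (hE : 2 * E ≤ |W j₀|) :
    (Finset.univ.filter fun a : Fin n → Fin R => |∑ j, ((a j : ℕ) : ℤ) * W j| < E).card * R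
      ≤ R ^ n := by
  refine card_mul_le_of_unique_coord _ j₀ fun a ha b hb hab => ?_
  rw [Finset.mem_filter] at ha hb
  have hd : (∑ j, ((a j : ℕ) : ℤ) * W j) - ∑ j, ((b j : ℕ) : ℤ) * W j
      = (((a j₀ : ℕ) : ℤ) - (b j₀ : ℕ)) * W j₀ := by
    rw [← Finset.sum_sub_distrib, Finset.sum_eq_single j₀]
    · ring
    · intro j _ hj
      rw [hab j hj]; ring
    · simp
  have hlt : |(((a j₀ : ℕ) : ℤ) - (b j₀ : ℕ)) * W j₀| < 2 * E := by
    rw [← hd]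
    calc _ ≤ _ := abs_sub _ _
      _ < 2 * E := by linarith [ha.2, hb.2]
  have h0 : (((a j₀ : ℕ) : ℤ) - (b j₀ : ℕ)) = 0 := by
    by_contra hne
    have h1 : 1 ≤ |(((a j₀ : ℕ) : ℤ) - (b j₀ : ℕ))| := Int.one_le_abs hne
    rw [abs_mul] at hlt
    nlinarith [abs_nonneg (W j₀)]
  funext j
  by_cases hj : j = j₀
  · subst hj
    apply Fin.ext
    omega
  · exact hab j hj

/-- The integer vectors with at most `r` nonzero entries, all of absolute value at most `N`,
are the values of a function on at most `(n * (2 * N + 1)) ^ r` codes. -/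
theorem exists_sparse_cover (n r N : ℕ) :
    ∃ F : (Fin r → Fin n × Fin (2 * N + 1)) → (Fin n → ℤ),
      ∀ W : Fin n → ℤ, W ≠ 0 → (Finset.univ.filter fun j => W j ≠ 0).card ≤ r →
        (∀ j, |W j| ≤ N) → ∃ c, F c = W := by
  classical
  -- A code may list a position several times. This is harmless for the codes used below, where the
  -- value is determined by the position; repetitions fill up supports with fewer than `r` elements.
  refine ⟨fun c j => if h : ∃ i, (c i).1 = j then ((c h.choose).2 : ℤ) - N else 0, ?_⟩
  intro W hW hr hN
  set T := Finset.univ.filter fun j => W j ≠ 0 with hT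
  obtain ⟨j₀, hj₀⟩ : ∃ j, W j ≠ 0 := by
    by_contra! h
    exact hW (funext h)
  have : Nonempty T := ⟨⟨j₀, by simp [hT, hj₀]⟩⟩
  obtain ⟨f⟩ : Nonempty (T ↪ Fin r) :=
    Function.Embedding.nonempty_of_card_le (by simpa using hr)
  have hb : ∀ j, (W j + N).toNat < 2 * N + 1 := fun j => by
    have := abs_le.1 (hN j)
    omega
  let p : Fin r → T := Function.invFun f
  refine ⟨fun i => ((p i : Fin n), ⟨(W (p i) + N).toNat, hb _⟩), ?_⟩
  funext j
  by_cases h : ∃ i, ((p i : T) : Fin n) = j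
  · have h' := h.choose_spec
    simp only [h, dite_true]
    rw [h']
    have := abs_le.1 (hN j)
    omega
  · simp only [h, dite_false]
    by_contra hne
    refine h ⟨f ⟨j, by simp [hT, Ne.symm hne]⟩, ?_⟩
    simp only [p, Function.leftInverse_invFun f.injective _]

/-- Union bound: for a fixed `W`, all `m` independent rows fail with probability at most `n ^ (-m)`,
and `hcard` says that there are fewer than `n ^ m` codes for `W`. -/
theorem exists_integer_matrix {n m s N : ℕ} {E : ℤ} (hEN : 2 * E ≤ N)
    (hE : 0 < E)
    (hcard : (n * (2 * N + 1)) ^ (2 * s) < n ^ m) :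
    ∃ A : Fin m → Fin n → Fin n, ∀ W : Fin n → ℤ,
      (Finset.univ.filter fun j => W j ≠ 0).card ≤ 2 * s → (∀ j, |W j| ≤ N) →
      (∃ j, |W j| = N) → ∃ i, E ≤ |∑ j, ((A i j : ℕ) : ℤ) * W j| := by
  classical
  obtain ⟨F, hF⟩ := exists_sparse_cover n (2 * s) N
  by_contra! hcon
  let row : (Fin n → ℤ) → Finset (Fin n → Fin n) := fun W =>
    Finset.univ.filter fun a => |∑ j, ((a j : ℕ) : ℤ) * W j| < E
  let codes : Finset (Fin (2 * s) → Fin n × Fin (2 * N + 1)) :=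
    Finset.univ.filter fun c => ∃ j, |F c j| = N
  have hcov : (Finset.univ : Finset (Fin m → Fin n → Fin n))
      ⊆ codes.biUnion fun c => Fintype.piFinset fun _ => row (F c) := by
    intro A _
    obtain ⟨W, h1, h2, ⟨j, h3⟩, h4⟩ := hcon A
    have hW : W ≠ 0 := by
      rintro rfl
      simp only [Pi.zero_apply, abs_zero] at h3
      omega
    obtain ⟨c, rfl⟩ := hF W hW h1 h2
    simp only [Finset.mem_biUnion, codes, Finset.mem_filter, Finset.mem_univ, true_and,
      Fintype.mem_piFinset, row]
    exact ⟨c, ⟨j, h3⟩, h4⟩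
  have hrow : ∀ c ∈ codes, (row (F c)).card * n ≤ n ^ n := by
    intro c hc
    obtain ⟨j, hj⟩ := (Finset.mem_filter.1 hc).2
    exact card_rows_mul_le _ j E (by rw [hj]; exact hEN)
  have h1 : (n ^ n) ^ m ≤ ∑ c ∈ codes, (row (F c)).card ^ m := by
    calc (n ^ n) ^ m = (Finset.univ : Finset (Fin m → Fin n → Fin n)).card := by simp
      _ ≤ _ := Finset.card_le_card hcov
      _ ≤ _ := Finset.card_biUnion_le
      _ = _ := by simp
  have h2 : (n ^ n) ^ m * n ^ m ≤ (n * (2 * N + 1)) ^ (2 * s) * (n ^ n) ^ m := by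
    calc (n ^ n) ^ m * n ^ m ≤ (∑ c ∈ codes, (row (F c)).card ^ m) * n ^ m :=
          Nat.mul_le_mul_right _ h1
      _ = ∑ c ∈ codes, ((row (F c)).card * n) ^ m := by
          rw [Finset.sum_mul]; simp only [mul_pow]
      _ ≤ ∑ c ∈ codes, (n ^ n) ^ m :=
          Finset.sum_le_sum fun c hc => Nat.pow_le_pow_left (hrow c hc) m
      _ = codes.card * (n ^ n) ^ m := by simp
      _ ≤ _ := by
          refine Nat.mul_le_mul_right _ ?_
          calc codes.card ≤ _ := Finset.card_le_univ _
            _ = _ := by simp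
  have hpos : 0 < (n ^ n) ^ m := by
    rcases Nat.eq_zero_or_pos n with h | h
    · subst h; simp
    · positivity
  rw [mul_comm] at h2
  exact absurd (Nat.le_of_mul_le_mul_right h2 hpos) (not_le.2 hcard)

/-- There are integer matrices with `8 s + 1` rows that are well conditioned on all differences of
`s`-sparse vectors. -/
theorem exists_robust_matrix {n m s : ℕ} (hn : 11 ≤ n) (hs : s ≤ n) (hm : 8 * s < m) :
    ∃ A : Fin m → Fin n → ℕ, (∀ i j, A i j ≤ n) ∧ ∀ w : Fin n → ℝ,
      (Finset.univ.filter fun j => w j ≠ 0).card ≤ 2 * s → ∀ ε : ℝ,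
      (∀ i, |∑ j, (A i j : ℝ) * w j| ≤ ε) → ∀ j, |w j| ≤ 5 * (n : ℝ) ^ 2 * ε := by
  -- Each of the `2 * s` code entries has at most `n ^ 4` values as soon as `10 n ^ 2 + 1 ≤ n ^ 3`;
  -- hence the `8 * s` and the `11 ≤ n`.
  have hcard : (n * (2 * (5 * n ^ 2) + 1)) ^ (2 * s) < n ^ m := by
    have h1 : n * (2 * (5 * n ^ 2) + 1) ≤ n ^ 4 := by
      have : 2 * (5 * n ^ 2) + 1 ≤ n ^ 3 := by nlinarith
      calc _ ≤ n * n ^ 3 := Nat.mul_le_mul_left _ this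
        _ = n ^ 4 := by ring
    calc _ ≤ (n ^ 4) ^ (2 * s) := Nat.pow_le_pow_left h1 _
      _ = n ^ (8 * s) := by rw [← pow_mul]; ring_nf
      _ < n ^ m := Nat.pow_lt_pow_right (by omega) hm
  -- Rounding a `2 s`-sparse vector changes a measurement by at most `2 s n`; the margin `E` exceeds
  -- this by `1`, and `N = 5 n ^ 2` leaves room for `2 * E`.
  have hEN : 2 * (((2 * s * n + 1 : ℕ)) : ℤ) ≤ ((5 * n ^ 2 : ℕ) : ℤ) := by
    have : 2 * (2 * s * n + 1) ≤ 5 * n ^ 2 := by nlinarith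
    exact_mod_cast this
  obtain ⟨A, hA⟩ := exists_integer_matrix (m := m) (s := s) hEN (by positivity) hcard
  refine ⟨fun i j => A i j, fun i j => (A i j).2.le, fun w hw ε hε => ?_⟩
  have : Nonempty (Fin n) := ⟨⟨0, by omega⟩⟩
  obtain ⟨j₀, hj₀⟩ := Finite.exists_max fun j => |w j|
  intro j
  refine (hj₀ j).trans ?_
  by_contra! hlt
  set N : ℝ := 5 * (n : ℝ) ^ 2 with hN
  set μ := |w j₀| with hμ
  have hNpos : 0 < N := by positivity
  have hm0 : 0 < m := by omega
  have hε0 : 0 ≤ ε := (abs_nonneg _).trans (hε ⟨0, hm0⟩)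
  have hμ0 : 0 < μ := lt_of_le_of_lt (by positivity) hlt
  -- After scaling, the largest entry is exactly `±N` and survives rounding, and zeros stay zero. If
  -- `N * ε < μ`, the scaled measurements are below `1`, so those of `W` are below `2 s n + 1`,
  -- against the choice of `A`.
  let W : Fin n → ℤ := fun j => ⌊N * (w j / μ)⌋
  have hw1 : ∀ j, |w j / μ| ≤ 1 := fun j => by
    rw [abs_div, abs_of_pos hμ0]
    exact div_le_one_of_le₀ (hj₀ j) hμ0.le
  have hWz : ∀ j, w j = 0 → W j = 0 := fun j hj => by simp [W, hj]
  have hcN : ((5 * n ^ 2 : ℕ) : ℝ) = N := by push_cast; rfl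
  obtain ⟨i, hi⟩ := hA W
    ((Finset.card_le_card (Finset.monotone_filter_right _ fun j _ hj h => hj (hWz j h))).trans hw)
    (fun j => by
      have h1 := abs_le.1 (hw1 j)
      rw [abs_le]
      constructor
      · rw [Int.le_floor]
        push_cast
        nlinarith [h1.1]
      · rw [← Int.lt_add_one_iff, Int.floor_lt]
        push_cast
        nlinarith [h1.2])
    (by
      refine ⟨j₀, ?_⟩
      have hc : ((5 * n ^ 2 : ℕ) : ℤ) = ⌊N⌋ := by
        rw [← hcN, Int.floor_natCast]
      rcases abs_choice (w j₀) with h | h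
      · have : w j₀ / μ = 1 := by rw [hμ, h, div_self]; rw [← h]; exact hμ0.ne'
        simp only [W, this, mul_one, ← hcN, Int.floor_natCast, Nat.abs_cast]
      · have : w j₀ / μ = -1 := by
          rw [hμ, h, div_neg, div_self]; intro h'; rw [h'] at hμ; simp at hμ; exact hμ0.ne' hμ
        simp only [W, this, mul_neg, mul_one, ← hcN, Int.floor_neg, Int.ceil_natCast, abs_neg,
          Nat.abs_cast])
  have hi' : ((2 * s * n + 1 : ℕ) : ℝ) ≤ |∑ j, ((A i j : ℕ) : ℝ) * (W j : ℝ)| := by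
    have : (((2 * s * n + 1 : ℕ) : ℤ) : ℝ) ≤ ((|∑ j, ((A i j : ℕ) : ℤ) * W j| : ℤ) : ℝ) :=
      Int.cast_le.2 hi
    push_cast at this
    push_cast
    exact this
  have hsplit : ∑ j, ((A i j : ℕ) : ℝ) * (W j : ℝ)
      = N / μ * (∑ j, ((A i j : ℕ) : ℝ) * w j)
        + ∑ j, ((A i j : ℕ) : ℝ) * ((W j : ℝ) - N * (w j / μ)) := by
    rw [Finset.mul_sum, ← Finset.sum_add_distrib]
    refine Finset.sum_congr rfl fun j _ => ?_
    ring
  have hterm : ∀ j, |((A i j : ℕ) : ℝ) * ((W j : ℝ) - N * (w j / μ))|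
      ≤ if w j ≠ 0 then (n : ℝ) else 0 := by
    intro j
    split_ifs with h
    · rw [abs_mul]
      have h1 : |((A i j : ℕ) : ℝ)| ≤ n := by
        rw [Nat.abs_cast]; exact_mod_cast (A i j).2.le
      have h2 : |(W j : ℝ) - N * (w j / μ)| ≤ 1 := by
        rw [abs_le]
        have := Int.floor_le (N * (w j / μ))
        have := Int.lt_floor_add_one (N * (w j / μ))
        constructor <;> simp only [W] <;> linarith
      calc _ ≤ (n : ℝ) * 1 := mul_le_mul h1 h2 (abs_nonneg _) (by positivity)
        _ = n := mul_one _
    · push Not at h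
      simp [hWz j h, h]
  have hrem : |∑ j, ((A i j : ℕ) : ℝ) * ((W j : ℝ) - N * (w j / μ))| ≤ 2 * s * n := by
    calc _ ≤ ∑ j, |((A i j : ℕ) : ℝ) * ((W j : ℝ) - N * (w j / μ))| :=
          Finset.abs_sum_le_sum_abs _ _
      _ ≤ ∑ j, if w j ≠ 0 then (n : ℝ) else 0 := Finset.sum_le_sum fun j _ => hterm j
      _ = (Finset.univ.filter fun j => w j ≠ 0).card * (n : ℝ) := by
          rw [← Finset.sum_filter]; simp
      _ ≤ (2 * s : ℕ) * (n : ℝ) := by gcongr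
      _ = 2 * s * n := by push_cast; ring
  have hmain : |N / μ * (∑ j, ((A i j : ℕ) : ℝ) * w j)| < 1 := by
    rw [abs_mul, abs_of_pos (by positivity)]
    calc _ ≤ N / μ * ε := mul_le_mul_of_nonneg_left (hε i) (by positivity)
      _ < 1 := by rw [div_mul_eq_mul_div, div_lt_one hμ0]; exact hlt
  rw [hsplit] at hi'
  have := abs_add_le (N / μ * (∑ j, ((A i j : ℕ) : ℝ) * w j))
    (∑ j, ((A i j : ℕ) : ℝ) * ((W j : ℝ) - N * (w j / μ)))
  push_cast at hi'
  linarith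

/-! ### Crowded blocks of a random support -/

/-- Such an `S` contains some `τ`-subset `W` of `U`, and its remaining `k - τ` elements lie outside
`W`. -/
theorem card_le_inter_le {n : ℕ} (U : Finset (Fin n)) (k τ : ℕ) :
    ((Finset.powersetCard k (Finset.univ : Finset (Fin n))).filter
      fun S => τ ≤ (S ∩ U).card).card ≤ U.card.choose τ * (n - τ).choose (k - τ) := by
  classical
  have hsub : ((Finset.powersetCard k (Finset.univ : Finset (Fin n))).filter
      fun S => τ ≤ (S ∩ U).card) ⊆ (Finset.powersetCard τ U).biUnion fun W =>
        (Finset.powersetCard (k - τ) Wᶜ).image fun V => W ∪ V := by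
    intro S hS
    rw [Finset.mem_filter, Finset.mem_powersetCard] at hS
    obtain ⟨W, hW, hWc⟩ := Finset.exists_subset_card_eq hS.2
    have hWS : W ⊆ S := hW.trans Finset.inter_subset_left
    rw [Finset.mem_biUnion]
    refine ⟨W, Finset.mem_powersetCard.2 ⟨hW.trans Finset.inter_subset_right, hWc⟩, ?_⟩
    rw [Finset.mem_image]
    refine ⟨S \ W, Finset.mem_powersetCard.2 ⟨fun x hx => ?_, ?_⟩, ?_⟩
    · rw [Finset.mem_compl]; exact (Finset.mem_sdiff.1 hx).2
    · rw [Finset.card_sdiff_of_subset hWS, hS.1.2, hWc]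
    · rw [Finset.union_sdiff_of_subset hWS]
  calc _ ≤ _ := Finset.card_le_card hsub
    _ ≤ _ := Finset.card_biUnion_le
    _ ≤ ∑ W ∈ Finset.powersetCard τ U, (n - τ).choose (k - τ) := by
        refine Finset.sum_le_sum fun W hW => Finset.card_image_le.trans ?_
        rw [Finset.card_powersetCard, Finset.card_compl, (Finset.mem_powersetCard.1 hW).2,
          Fintype.card_fin]
    _ = _ := by simp

theorem descFactorial_mul_pow_le {u n : ℕ} (h : u ≤ n) (τ : ℕ) :
    u.descFactorial τ * n ^ τ ≤ n.descFactorial τ * u ^ τ := by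
  induction τ with
  | zero => simp
  | succ τ ih =>
    rw [Nat.descFactorial_succ, Nat.descFactorial_succ, pow_succ, pow_succ]
    have h1 : (u - τ) * n ≤ (n - τ) * u := by
      rcases le_total u τ with h' | h'
      · simp [Nat.sub_eq_zero_of_le h']
      · zify [h', h'.trans h]
        have : (u : ℤ) ≤ n := by exact_mod_cast h
        nlinarith
    calc _ = ((u - τ) * n) * (u.descFactorial τ * n ^ τ) := by ring
      _ ≤ ((n - τ) * u) * (n.descFactorial τ * u ^ τ) := Nat.mul_le_mul h1 ih
      _ = _ := by ring

theorem pow_le_three_pow_mul_factorial (τ : ℕ) : τ ^ τ ≤ 3 ^ τ * τ.factorial := by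
  have h := Real.pow_div_factorial_le_exp (τ : ℝ) (by positivity) τ
  rw [div_le_iff₀ (by positivity)] at h
  have h2 : Real.exp (τ : ℝ) ≤ 3 ^ τ := by
    rw [← mul_one (τ : ℝ), Real.exp_nat_mul]
    gcongr
    exact Real.exp_one_lt_three.le
  have : (τ : ℝ) ^ τ ≤ 3 ^ τ * τ.factorial :=
    h.trans (mul_le_mul_of_nonneg_right h2 (by positivity))
  exact_mod_cast this

/-- A hypergeometric tail: relative to `n.choose k` the count is `u.choose τ * k.choose τ / n.choose
τ`, at most `(u / n) ^ τ * k ^ τ / τ!`. With `τ ^ τ ≤ 3 ^ τ * τ!` this is at most `(3 u k / (n τ)) ^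
τ ≤ 4 ^ (-τ)`. -/
theorem choose_mul_choose_mul_four_pow_le {n k u τ : ℕ} (hu : u ≤ n) (hn : 0 < n) (hτ : τ ≤ k)
        (h : 12 * u * k ≤ n * τ) :
    u.choose τ * (n - τ).choose (k - τ) * 4 ^ τ ≤ n.choose k := by
  have hc : n.choose k * k.choose τ = n.choose τ * (n - τ).choose (k - τ) := Nat.choose_mul hτ
  have hkey : u.choose τ * k.choose τ * 4 ^ τ ≤ n.choose τ := by
    have hf := Nat.factorial_pos τ
    have hu1 : u.choose τ * τ.factorial = u.descFactorial τ := by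
      rw [Nat.descFactorial_eq_factorial_mul_choose, mul_comm]
    have hn1 : n.choose τ * τ.factorial = n.descFactorial τ := by
      rw [Nat.descFactorial_eq_factorial_mul_choose, mul_comm]
    have hk1 : k.choose τ * τ.factorial ≤ k ^ τ := by
      rw [mul_comm, ← Nat.descFactorial_eq_factorial_mul_choose]
      exact Nat.descFactorial_le_pow k τ
    have h0 := descFactorial_mul_pow_le hu τ
    have h12 : (12 * u * k) ^ τ ≤ (n * τ) ^ τ := Nat.pow_le_pow_left h τ
    have h3 := pow_le_three_pow_mul_factorial τ
    have hpos : 0 < 3 ^ τ * τ.factorial * τ.factorial * n ^ τ := by positivity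
    refine Nat.le_of_mul_le_mul_right ?_ hpos
    calc u.choose τ * k.choose τ * 4 ^ τ * (3 ^ τ * τ.factorial * τ.factorial * n ^ τ)
        = (u.choose τ * τ.factorial * n ^ τ) * (k.choose τ * τ.factorial) * (4 ^ τ * 3 ^ τ) := by
          ring
      _ ≤ (n.choose τ * τ.factorial * u ^ τ) * k ^ τ * (4 ^ τ * 3 ^ τ) := by
          rw [hu1, hn1]
          gcongr
      _ = n.choose τ * τ.factorial * (12 * u * k) ^ τ := by
          rw [← mul_pow, mul_pow (12 * u), mul_pow 12]; ring
      _ ≤ n.choose τ * τ.factorial * (n * τ) ^ τ := Nat.mul_le_mul_left _ h12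
      _ = n.choose τ * τ.factorial * n ^ τ * τ ^ τ := by rw [mul_pow]; ring
      _ ≤ n.choose τ * τ.factorial * n ^ τ * (3 ^ τ * τ.factorial) := Nat.mul_le_mul_left _ h3
      _ = _ := by ring
  have hkτ : 0 < k.choose τ := Nat.choose_pos hτ
  refine Nat.le_of_mul_le_mul_right ?_ hkτ
  calc u.choose τ * (n - τ).choose (k - τ) * 4 ^ τ * k.choose τ
      = (u.choose τ * k.choose τ * 4 ^ τ) * (n - τ).choose (k - τ) := by ring
    _ ≤ n.choose τ * (n - τ).choose (k - τ) := Nat.mul_le_mul_right _ hkey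
    _ = n.choose k * k.choose τ := hc.symm

/-- The elements of `S` that lie in a fibre of `blk` containing more than `cap` elements of `S`. -/
def overload {n g : ℕ} (blk : Fin n → Fin g) (cap : ℕ) (S : Finset (Fin n)) : Finset (Fin n) :=
  S.filter fun j => cap < (S.filter fun i => blk i = blk j).card

theorem overload_mono {n g : ℕ} (blk : Fin n → Fin g) (cap : ℕ) {S T : Finset (Fin n)}
    (h : S ⊆ T) : overload blk cap S ⊆ overload blk cap T := by
  intro j hj
  rw [overload, Finset.mem_filter] at hj ⊢
  exact ⟨h hj.1, hj.2.trans_le (Finset.card_le_card (Finset.filter_subset_filter _ h))⟩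

/-- Union bound over the set `J` of crowded blocks. They hold at least `τ J = max g (J.card * cap)`
elements of `S`: all the overloaded ones, and more than `cap` in each block. Their total size is at
most `2 n J.card / g`, so the hypergeometric tail bounds the probability by `4 ^ (-τ J) ≤ 4 ^ (-g)`;
this beats the `2 ^ g` choices of `J`. Bounding the total overload, rather than forbidding it, is
what gives an error exponential in `g`. -/
theorem card_overload_mul_le {n g k cap F : ℕ} (blk : Fin n → Fin g) (hn : 0 < n)
    (hF : ∀ a, (Finset.univ.filter fun j => blk j = a).card ≤ F) (hFg : F * g ≤ 2 * n)
    (hcap : 24 * k ≤ cap * g) (hg : 0 < g) :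
    ((Finset.powersetCard k (Finset.univ : Finset (Fin n))).filter
      fun S => g ≤ (overload blk cap S).card).card * 2 ^ g ≤ n.choose k := by
  classical
  let Un : Finset (Fin g) → Finset (Fin n) := fun J => Finset.univ.filter fun j => blk j ∈ J
  let τ : Finset (Fin g) → ℕ := fun J => max g (J.card * cap)
  let fam : Finset (Fin g) → Finset (Finset (Fin n)) := fun J =>
    (Finset.powersetCard k (Finset.univ : Finset (Fin n))).filter fun S => τ J ≤ (S ∩ Un J).card
  have hsub : ((Finset.powersetCard k (Finset.univ : Finset (Fin n))).filter
      fun S => g ≤ (overload blk cap S).card) ⊆ Finset.univ.biUnion fam := by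
    intro S hS
    rw [Finset.mem_filter] at hS
    rw [Finset.mem_biUnion]
    refine ⟨(overload blk cap S).image blk, Finset.mem_univ _, ?_⟩
    rw [Finset.mem_filter]
    refine ⟨hS.1, max_le ?_ ?_⟩
    · refine hS.2.trans (Finset.card_le_card fun j hj => ?_)
      rw [Finset.mem_inter]
      exact ⟨(Finset.mem_filter.1 hj).1, by
        simp only [Un, Finset.mem_filter, Finset.mem_univ, true_and]
        exact Finset.mem_image_of_mem _ hj⟩
    · set J := (overload blk cap S).image blk with hJ
      have hmaps : ∀ j ∈ S ∩ Un J, blk j ∈ J := fun j hj => by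
        simpa [Un] using (Finset.mem_inter.1 hj).2
      rw [Finset.card_eq_sum_card_fiberwise hmaps, ← smul_eq_mul, ← Finset.sum_const]
      refine Finset.sum_le_sum fun a ha => ?_
      obtain ⟨j, hj, rfl⟩ := Finset.mem_image.1 ha
      refine (Finset.mem_filter.1 hj).2.le.trans (Finset.card_le_card fun i hi => ?_)
      rw [Finset.mem_filter] at hi
      simp only [Finset.mem_filter, Finset.mem_inter, Un, Finset.mem_univ, true_and, hi.2]
      exact ⟨⟨hi.1, ha⟩, trivial⟩
  have hfam : ∀ J, (fam J).card * 4 ^ g ≤ n.choose k := by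
    intro J
    rcases Nat.lt_or_ge k (τ J) with hk | hk
    · have : fam J = ∅ := by
        refine Finset.filter_eq_empty_iff.2 fun S hS h => ?_
        have h1 := Finset.card_le_card (Finset.inter_subset_left : S ∩ Un J ⊆ S)
        rw [(Finset.mem_powersetCard.1 hS).2] at h1
        omega
      simp [this]
    · have hUn : (Un J).card ≤ J.card * F := by
        have : Un J = J.biUnion fun a => Finset.univ.filter fun j => blk j = a := by
          ext j; simp [Un]
        rw [this]
        calc _ ≤ _ := Finset.card_biUnion_le
          _ ≤ ∑ a ∈ J, F := Finset.sum_le_sum fun a _ => hF a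
          _ = _ := by simp
      have h12 : 12 * (Un J).card * k ≤ n * τ J := by
        refine Nat.le_of_mul_le_mul_right ?_ hg
        calc 12 * (Un J).card * k * g ≤ 12 * (J.card * F) * k * g := by gcongr
          _ = 12 * J.card * k * (F * g) := by ring
          _ ≤ 12 * J.card * k * (2 * n) := by gcongr
          _ = J.card * n * (24 * k) := by ring
          _ ≤ J.card * n * (cap * g) := by gcongr
          _ = n * (J.card * cap) * g := by ring
          _ ≤ n * τ J * g := by gcongr; exact le_max_right _ _
      calc (fam J).card * 4 ^ g
          ≤ ((Un J).card.choose (τ J) * (n - τ J).choose (k - τ J)) * 4 ^ τ J :=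
            Nat.mul_le_mul (card_le_inter_le _ _ _)
              (Nat.pow_le_pow_right (by norm_num) (le_max_left _ _))
        _ ≤ n.choose k := choose_mul_choose_mul_four_pow_le
            ((Finset.card_le_univ _).trans (by simp)) hn hk h12
  have hpos : 0 < 2 ^ g := by positivity
  refine Nat.le_of_mul_le_mul_right ?_ hpos
  calc _ = ((Finset.powersetCard k (Finset.univ : Finset (Fin n))).filter
      fun S => g ≤ (overload blk cap S).card).card * 4 ^ g := by
        rw [mul_assoc, ← mul_pow, show 2 * 2 = 4 from rfl]
    _ ≤ (∑ J, (fam J).card) * 4 ^ g :=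
        Nat.mul_le_mul_right _ ((Finset.card_le_card hsub).trans Finset.card_biUnion_le)
    _ = ∑ J, (fam J).card * 4 ^ g := Finset.sum_mul _ _ _
    _ ≤ ∑ J : Finset (Fin g), n.choose k := Finset.sum_le_sum fun J _ => hfam J
    _ = n.choose k * 2 ^ g := by simp [mul_comm]

/-! ### Integer coordinates on the lattice -/

theorem exists_lattice_embedding (Λ : Submodule ℤ Plane) [DiscreteTopology Λ] [IsZLattice ℝ Λ] :
    ∃ (φ : ℤ × ℤ → Plane) (B : ℝ), 1 ≤ B ∧ Function.Injective φ ∧ (∀ p, φ p ∈ Λ) ∧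
      ∀ p p', dist (φ p) (φ p') ≤ B * (|(p.1 : ℝ) - p'.1| + |(p.2 : ℝ) - p'.2|) := by
  have hrank : Module.finrank ℤ Λ = 2 := by
    rw [ZLattice.rank ℝ]; simp
  have : Module.Free ℤ Λ := ZLattice.module_free ℝ Λ
  have : Module.Finite ℤ Λ := ZLattice.module_finite ℝ Λ
  let b : Module.Basis (Fin 2) ℤ Λ := Module.finBasisOfFinrankEq ℤ Λ hrank
  let f : ℤ × ℤ → Λ := fun p => p.1 • b 0 + p.2 • b 1
  have hf : Function.Injective f := by
    intro p p' h
    have h0 : ∀ p : ℤ × ℤ, b.repr (f p) 0 = p.1 := fun p => by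
      simp [f]
    have h1 : ∀ p : ℤ × ℤ, b.repr (f p) 1 = p.2 := fun p => by
      simp [f]
    exact Prod.ext (by rw [← h0, h, h0]) (by rw [← h1, h, h1])
  refine ⟨fun p => (f p : Plane), max 1 (max ‖(b 0 : Plane)‖ ‖(b 1 : Plane)‖), le_max_left _ _,
    Subtype.val_injective.comp hf, fun p => (f p).2, fun p p' => ?_⟩
  have he : ((f p : Λ) : Plane) - (f p' : Λ)
      = ((p.1 : ℝ) - p'.1) • (b 0 : Plane) + ((p.2 : ℝ) - p'.2) • (b 1 : Plane) := by
    have hz : ∀ (z : ℤ) (v : Plane), z • v = (z : ℝ) • v := fun z v =>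
      (Int.cast_smul_eq_zsmul ℝ z v).symm
    simp only [f, Submodule.coe_add, Submodule.coe_smul_of_tower, hz, sub_smul]
    abel
  rw [dist_eq_norm, he, mul_add]
  set B := max 1 (max ‖(b 0 : Plane)‖ ‖(b 1 : Plane)‖)
  refine (norm_add_le _ _).trans (add_le_add ?_ ?_)
  · rw [norm_smul, Real.norm_eq_abs, mul_comm]
    gcongr
    exact (le_max_left _ _).trans (le_max_right _ _)
  · rw [norm_smul, Real.norm_eq_abs, mul_comm]
    gcongr
    exact (le_max_right _ _).trans (le_max_right _ _)

/-! ### Measurability and evaluation of the bit-meters -/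

namespace DecodingCircuit

variable {Λ : Submodule ℤ Plane} {m n : ℕ} (ckt : DecodingCircuit Λ m n)

theorem measurableSet_traffic (t : ℕ) (u v : Node m n) (w : List Bool) :
    MeasurableSet {y | ckt.traffic y t u v = w} := by
  induction t generalizing u v w with
  | zero => simp [traffic]
  | succ t ih =>
    by_cases hs : ckt.slot u v = t
    · have hset : {y | ckt.traffic y (t + 1) u v = w}
          = ⋃ h : Node m n → List Bool, (⋂ x, {y | ckt.traffic y t x u = h x}) ∩
              {y | ckt.rule u v (stored y u) h = w} := by
        ext y
        simp only [traffic, hs, if_true, Set.mem_ofPred_eq, Set.mem_iUnion, Set.mem_inter_iff,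
          Set.mem_iInter]
        constructor
        · intro h
          exact ⟨fun x => ckt.traffic y t x u, fun _ => rfl, h⟩
        · rintro ⟨h, h1, h2⟩
          rw [funext h1]
          exact h2
      rw [hset]
      refine MeasurableSet.iUnion fun h => (MeasurableSet.iInter fun x => ih x u (h x)).inter ?_
      have hst : Measurable fun y : Fin m → ℂ => stored y u := by
        rcases u with i | j
        · exact measurable_pi_apply i
        · exact measurable_const
      exact hst (ckt.measurableSet_rule u v h w)
    · simpa [traffic, hs] using ih u v w

theorem measurable_bitMeters : Measurable ckt.bitMeters := by
  have hlen : ∀ u v, Measurable fun y => (ckt.message y u v).length := by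
    intro u v
    refine measurable_to_countable' fun l => ?_
    have : (fun y => (ckt.message y u v).length) ⁻¹' {l}
        = ⋃ w : {w : List Bool // w.length = l}, {y | ckt.traffic y ckt.rounds u v = w} := by
      ext y
      simp [message]
    rw [this]
    exact MeasurableSet.iUnion fun w => ckt.measurableSet_traffic _ _ _ _
  unfold bitMeters bitMetersOn bits
  refine Finset.measurable_sum _ fun u _ => Finset.measurable_sum _ fun v _ => ?_
  refine Measurable.div_const (Measurable.mul_const ?_ _) _
  exact measurable_from_top.comp ((hlen u v).add (hlen v u))

/-- The two directions contribute the same double sum after exchanging `u` and `v`, which absorbs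
the factor `1 / 2`. -/
theorem bitMeters_eq (y : Fin m → ℂ) :
    ckt.bitMeters y
      = ∑ u, ∑ v, ((ckt.message y u v).length : ℝ) * dist (ckt.pos u) (ckt.pos v) := by
  have h : ∑ u, ∑ v, ((ckt.message y v u).length : ℝ) * dist (ckt.pos u) (ckt.pos v)
      = ∑ u, ∑ v, ((ckt.message y u v).length : ℝ) * dist (ckt.pos u) (ckt.pos v) := by
    rw [Finset.sum_comm]
    simp only [dist_comm]
  have h2 : ckt.bitMeters y = (∑ u, ∑ v, ((ckt.message y u v).length : ℝ)
        * dist (ckt.pos u) (ckt.pos v) + ∑ u, ∑ v, ((ckt.message y v u).length : ℝ)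
        * dist (ckt.pos u) (ckt.pos v)) / 2 := by
    unfold bitMeters bitMetersOn bits
    rw [← Finset.sum_add_distrib, Finset.sum_div]
    refine Finset.sum_congr rfl fun u _ => ?_
    rw [← Finset.sum_add_distrib, Finset.sum_div]
    refine Finset.sum_congr rfl fun v _ => ?_
    push_cast
    ring
  rw [h2, h]
  ring

end DecodingCircuit

theorem measurable_measurement {m n : ℕ} (A : Matrix (Fin m) (Fin n) ℂ) :
    Measurable (measurement A) := by
  refine measurable_pi_lambda _ fun i => ?_
  simp only [measurement, Matrix.mulVec, dotProduct]
  fun_prop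

/-! ### The two-level protocol as a circuit -/

noncomputable section

/-- The tasks of the input-nodes in a two-level decoder: a hub fed by `a` sensors, `g` centres fed
by `b` sensors each, and `r` idle nodes. -/
inductive Role (g a b r : ℕ) : Type
  | hub : Role g a b r
  | centre (i : Fin g) : Role g a b r
  | sensor (s : Fin a) : Role g a b r
  | probe (i : Fin g) (s : Fin b) : Role g a b r
  | idle (s : Fin r) : Role g a b r

namespace Role

variable {g a b r : ℕ}

/-- The roles as a sum of index types. -/
def equivSum : Role g a b r ≃ Unit ⊕ Fin g ⊕ Fin a ⊕ (Fin g × Fin b) ⊕ Fin r where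
  toFun
    | hub => .inl ()
    | centre i => .inr (.inl i)
    | sensor s => .inr (.inr (.inl s))
    | probe i s => .inr (.inr (.inr (.inl (i, s))))
    | idle s => .inr (.inr (.inr (.inr s)))
  invFun
    | .inl _ => hub
    | .inr (.inl i) => centre i
    | .inr (.inr (.inl s)) => sensor s
    | .inr (.inr (.inr (.inl p))) => probe p.1 p.2
    | .inr (.inr (.inr (.inr s))) => idle s
  left_inv x := by cases x <;> rfl
  right_inv x := by rcases x with _ | _ | _ | _ | _ <;> rfl

instance : Fintype (Role g a b r) := Fintype.ofEquiv _ equivSum.symm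

theorem card_eq : Fintype.card (Role g a b r) = 1 + (g + (a + (g * b + r))) := by
  rw [Fintype.card_congr equivSum]; simp

theorem sum_eq {M : Type*} [AddCommMonoid M] (f : Role g a b r → M) :
    ∑ u, f u = f hub + (∑ i, f (centre i) + (∑ s, f (sensor s)
      + (∑ i, ∑ s, f (probe i s) + ∑ s, f (idle s)))) := by
  rw [← Equiv.sum_comp equivSum.symm f]
  simp [Fintype.sum_sum_type, Fintype.sum_prod_type, equivSum]

end Role

/-- A two-level decoding protocol. The sensors report to the hub and the probes to their centres.
The hub addresses the output-nodes and tells the centres whether to speak; a centre that was told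
to speak addresses the output-nodes of its block. In addition the hub sends `pad` bits to the first
sensor. If the number stored at the hub is `0`, then the hub addresses nobody. -/
structure Protocol (g a b n : ℕ) where
  pad : ℕ
  code : ℂ → List Bool
  measurableSet_code : ∀ S : Set (List Bool), MeasurableSet {z | code z ∈ S}
  blk : Fin n → Fin g
  go : (Fin a → List Bool) → Fin g → List Bool
  hubOut : (Fin a → List Bool) → Fin n → List Bool
  centreOut : Fin g → (Fin b → List Bool) → Fin n → List Bool
  value : ℕ → ℝ
  value_zero : value 0 = 0

namespace Protocol

variable {g a b r n : ℕ} (p : Protocol g a b n)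

/-- The string that the protocol sends over a link. -/
def rule : Role g a b r ⊕ Fin n → Role g a b r ⊕ Fin n → ℂ →
    (Role g a b r ⊕ Fin n → List Bool) → List Bool
  | .inl .hub, .inl (.sensor s), _, _ => if (s : ℕ) = 0 then List.replicate p.pad true else []
  | .inl .hub, .inl (.centre i), z, h =>
      open Classical in if z = 0 then [] else p.go (fun s => h (.inl (.sensor s))) i
  | .inl .hub, .inr j, z, h =>
      open Classical in if z = 0 then [] else p.hubOut (fun s => h (.inl (.sensor s))) j
  | .inl (.sensor _), .inl .hub, z, _ => p.code z
  | .inl (.probe i _), .inl (.centre i'), z, _ => if i = i' then p.code z else []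
  | .inl (.centre i), .inr j, _, h =>
      if p.blk j = i ∧ h (.inl .hub) ≠ [] then
        p.centreOut i (fun s => h (.inl (.probe i s))) j else []
  | _, _, _, _ => []

/-- The time at which a link is used. -/
def slot : Role g a b r ⊕ Fin n → ℕ
  | .inl .hub => 1
  | .inl (.centre _) => 2
  | _ => 0

/-- The string sent over a link during the whole computation. -/
def final (y : Role g a b r → ℂ) : Role g a b r ⊕ Fin n → Role g a b r ⊕ Fin n → List Bool
  | .inl .hub, .inl (.sensor s) => if (s : ℕ) = 0 then List.replicate p.pad true else []
  | .inl .hub, .inl (.centre i) =>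
      open Classical in if y .hub = 0 then [] else p.go (fun s => p.code (y (.sensor s))) i
  | .inl .hub, .inr j =>
      open Classical in if y .hub = 0 then [] else p.hubOut (fun s => p.code (y (.sensor s))) j
  | .inl (.sensor s), .inl .hub => p.code (y (.sensor s))
  | .inl (.probe i s), .inl (.centre i') => if i = i' then p.code (y (.probe i s)) else []
  | .inl (.centre i), .inr j =>
      open Classical in
      if p.blk j = i ∧ (if y .hub = 0 then [] else
        p.go (fun s => p.code (y (.sensor s))) i) ≠ [] then
        p.centreOut i (fun s => p.code (y (.probe i s))) j else []
  | _, _ => []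

theorem measurableSet_rule (u v : Role g a b r ⊕ Fin n) (h : Role g a b r ⊕ Fin n → List Bool)
    (w : List Bool) : MeasurableSet {z | p.rule u v z h = w} := by
  classical
  have hcode := p.measurableSet_code {w}
  have hz : ∀ l : List Bool, MeasurableSet {z : ℂ | (if z = 0 then [] else l) = w} := by
    intro l
    have : {z : ℂ | (if z = 0 then [] else l) = w}
        = ({0} ∩ {_z : ℂ | [] = w}) ∪ ({0}ᶜ ∩ {_z : ℂ | l = w}) := by
      ext z
      by_cases h : z = 0 <;> simp [h]
    rw [this]
    exact ((measurableSet_singleton _).inter (MeasurableSet.const _)).union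
      ((measurableSet_singleton _).compl.inter (MeasurableSet.const _))
  rcases u with u | u <;> rcases v with v | v <;> try cases u <;> try cases v
  all_goals simp only [rule]
  all_goals first
    | exact MeasurableSet.const _
    | exact hcode
    | exact hz _
    | (split_ifs
       · exact hcode
       · exact MeasurableSet.const _)

variable {m : ℕ} {Λ : Submodule ℤ Plane} (e : Fin m ≃ Role g a b r)
  (pos : Role g a b r ⊕ Fin n → Plane)

/-- The nodes of a circuit, labelled with their roles. -/
def label (e : Fin m ≃ Role g a b r) : Node m n ≃ Role g a b r ⊕ Fin n :=
  e.sumCongr (Equiv.refl _)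

/-- The circuit that runs a protocol. -/
def circuit (hinj : Function.Injective pos) (hpos : ∀ u, pos u ∈ Λ) :
    DecodingCircuit Λ m n where
  substrate := Set.range pos
  isCompact_substrate := (Set.finite_range pos).isCompact
  pos u := pos (label e u)
  pos_injective := hinj.comp (label e).injective
  pos_mem u := ⟨hpos _, Set.mem_range_self _⟩
  rounds := 3
  slot u _ := slot (label e u)
  rule u v z h := p.rule (label e u) (label e v) z fun w => h ((label e).symm w)
  rule_self u z h := by
    rcases label e u with (_ | _ | _ | _ | _) | _ <;> rfl
  measurableSet_rule u v h w := p.measurableSet_rule _ _ _ _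
  out j h := p.value (∑ w, (h w).length)
  out_silent j := by simp [p.value_zero]

variable (hinj : Function.Injective pos) (hpos : ∀ u, pos u ∈ Λ)

/-- Sensors and probes speak at time `0`, the hub at time `1`, the centres at time `2`, so all
strings that a rule consults have arrived when it is applied and the recursion has this closed form.
-/
theorem message_circuit (y : Fin m → ℂ) (u v : Role g a b r ⊕ Fin n) :
    (p.circuit e pos hinj hpos).message y ((label e).symm u) ((label e).symm v)
      = p.final (fun i => y (e.symm i)) u v := by
  set c := p.circuit e pos hinj hpos with hc
  have hst : ∀ i, DecodingCircuit.stored (n := n) y ((label e).symm (.inl i)) = y (e.symm i) :=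
    fun i => rfl
  have hsucc : ∀ t u v, c.traffic y (t + 1) ((label e).symm u) ((label e).symm v)
      = if slot u = t then p.rule u v (DecodingCircuit.stored y ((label e).symm u))
          (fun w => c.traffic y t ((label e).symm w) ((label e).symm u))
        else c.traffic y t ((label e).symm u) ((label e).symm v) := by
    intro t u v
    simp [hc, DecodingCircuit.traffic, circuit]
  change c.traffic y 3 _ _ = _
  rcases u with u | u <;> rcases v with v | v <;> try cases u <;> try cases v
  all_goals simp [hsucc, slot, rule, final, hst]

/-- Only the hub and the centre of its own block ever address an output-node. The node uses nothing
but the number of bits received, which is enough because addresses are unary. -/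
theorem recover_circuit (y : Fin m → ℂ) (j : Fin n) :
    (p.circuit e pos hinj hpos).recover y j
      = p.value ((p.final (r := r) (fun i => y (e.symm i)) (.inl .hub) (.inr j)).length
        + (p.final (r := r) (fun i => y (e.symm i)) (.inl (.centre (p.blk j))) (.inr j)).length) := by
  change p.value (∑ w, ((p.circuit e pos hinj hpos).message y w (Sum.inr j)).length) = _
  congr 1
  have hj : (Sum.inr j : Node m n) = (label e).symm (.inr j) := rfl
  rw [← Equiv.sum_comp (label e).symm, hj]
  simp only [message_circuit, Fintype.sum_sum_type, Role.sum_eq]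
  have : ∀ i, i ≠ p.blk j →
      (p.final (fun i => y (e.symm i)) (.inl (.centre i)) (.inr j)).length = 0 := by
    intro i hi
    simp [final, Ne.symm hi]
  rw [Finset.sum_eq_single (p.blk j) (fun i _ hi => this i hi) (by simp)]
  simp [final]

/-- The three length scales are the cluster of the hub (`D₁`), a cell (`D₂`) and the whole circuit
(`D₃`); here `β` is the length of a report. The padding is kept as an exact separate term, to be
tuned later. -/
theorem bitMeters_circuit_le {D₁ D₂ D₃ : ℝ} {β W₁ W₂ : ℕ} (hD₂ : 0 ≤ D₂) (hD₃ : 0 ≤ D₃)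
    (s₀ : Fin a) (hs₀ : (s₀ : ℕ) = 0)
    (h₁ : ∀ s, dist (pos (.inl (.sensor s))) (pos (.inl .hub)) ≤ D₁)
    (h₂ : ∀ i s, dist (pos (.inl (.probe i s))) (pos (.inl (.centre i))) ≤ D₂)
    (h₂' : ∀ j, dist (pos (.inl (.centre (p.blk j)))) (pos (.inr j)) ≤ D₂)
    (h₃ : ∀ i, dist (pos (.inl .hub)) (pos (.inl (.centre i))) ≤ D₃)
    (h₃' : ∀ j, dist (pos (.inl .hub)) (pos (.inr j)) ≤ D₃)
    (y : Fin m → ℂ) (hcode : ∀ s, (p.code (y (e.symm (.sensor s)))).length ≤ β)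
    (hcode' : ∀ i s, (p.code (y (e.symm (.probe i s)))).length ≤ β)
    (hgo : ∀ h i, (p.go h i).length ≤ 1) (hout : ∀ h, ∑ j, (p.hubOut h j).length ≤ W₁)
    (hcout : ∀ i h, ∑ j, (p.centreOut i h j).length ≤ W₂) :
    (p.circuit e pos hinj hpos).bitMeters y
      ≤ p.pad * dist (pos (.inl .hub)) (pos (.inl (.sensor s₀)))
        + (g * D₃ + W₁ * D₃ + a * β * D₁ + g * b * β * D₂ + g * W₂ * D₂) := by
  classical
  have hpos' : ∀ u, (p.circuit e pos hinj hpos).pos ((label e).symm u) = pos u := fun u => by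
    simp [circuit]
  set f := p.final (r := r) (fun i => y (e.symm i)) with hf
  have hsum : (p.circuit e pos hinj hpos).bitMeters y
      = ∑ u, ∑ v, ((f u v).length : ℝ) * dist (pos u) (pos v) := by
    rw [DecodingCircuit.bitMeters_eq, ← Equiv.sum_comp (label e).symm]
    refine Finset.sum_congr rfl fun u _ => ?_
    rw [← Equiv.sum_comp (label e).symm]
    simp only [message_circuit, hpos', hf]
  have hpad : ∑ s, ((f (.inl .hub) (.inl (.sensor s))).length : ℝ)
      * dist (pos (.inl .hub)) (pos (.inl (.sensor s)))
      = p.pad * dist (pos (.inl .hub)) (pos (.inl (.sensor s₀))) := by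
    rw [Finset.sum_eq_single s₀]
    · simp [hf, final, hs₀]
    · intro s _ hs
      have : (s : ℕ) ≠ 0 := fun h => hs (Fin.ext (h.trans hs₀.symm))
      simp [hf, final, this]
    · simp
  have hflag : ∑ i, ((f (.inl .hub) (.inl (.centre i))).length : ℝ)
      * dist (pos (.inl .hub)) (pos (.inl (.centre i))) ≤ g * D₃ := by
    calc _ ≤ ∑ _i : Fin g, (1 : ℝ) * D₃ := by
          refine Finset.sum_le_sum fun i _ => ?_
          refine mul_le_mul ?_ (h₃ i) dist_nonneg zero_le_one
          simp only [hf, final]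
          split_ifs
          · simp
          · exact_mod_cast hgo _ _
      _ = g * D₃ := by simp
  have hhub : ∑ j, ((f (.inl .hub) (.inr j)).length : ℝ)
      * dist (pos (.inl .hub)) (pos (.inr j)) ≤ W₁ * D₃ := by
    calc _ ≤ ∑ j, ((f (.inl .hub) (.inr j)).length : ℝ) * D₃ :=
          Finset.sum_le_sum fun j _ => mul_le_mul_of_nonneg_left (h₃' j) (by positivity)
      _ = ((∑ j, (f (.inl .hub) (.inr j)).length : ℕ) : ℝ) * D₃ := by
          rw [← Finset.sum_mul]; push_cast; rfl
      _ ≤ W₁ * D₃ := by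
          refine mul_le_mul_of_nonneg_right (Nat.cast_le.2 ?_) hD₃
          simp only [hf, final]
          split_ifs
          · simp
          · exact hout _
  have hsens : ∑ s, ((f (.inl (.sensor s)) (.inl .hub)).length : ℝ)
      * dist (pos (.inl (.sensor s))) (pos (.inl .hub)) ≤ a * β * D₁ := by
    calc _ ≤ ∑ _s : Fin a, (β : ℝ) * D₁ := by
          refine Finset.sum_le_sum fun s _ => ?_
          refine mul_le_mul ?_ (h₁ s) dist_nonneg (by positivity)
          exact Nat.cast_le.2 (hcode s)
      _ = a * β * D₁ := by simp [mul_assoc]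
  have hprobe : ∑ i, ∑ s, ∑ i', ((f (.inl (.probe i s)) (.inl (.centre i'))).length : ℝ)
      * dist (pos (.inl (.probe i s))) (pos (.inl (.centre i'))) ≤ g * b * β * D₂ := by
    calc _ ≤ ∑ _i : Fin g, ∑ _s : Fin b, (β : ℝ) * D₂ := by
          refine Finset.sum_le_sum fun i _ => Finset.sum_le_sum fun s _ => ?_
          rw [Finset.sum_eq_single i]
          · refine mul_le_mul ?_ (h₂ i s) dist_nonneg (by positivity)
            simp only [hf, final, if_true]
            exact Nat.cast_le.2 (hcode' i s)
          · intro i' _ hi'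
            simp [hf, final, Ne.symm hi']
          · simp
      _ = g * b * β * D₂ := by simp [mul_assoc]
  have hcentre : ∑ i, ∑ j, ((f (.inl (.centre i)) (.inr j)).length : ℝ)
      * dist (pos (.inl (.centre i))) (pos (.inr j)) ≤ g * W₂ * D₂ := by
    calc _ ≤ ∑ _i : Fin g, (W₂ : ℝ) * D₂ := by
          refine Finset.sum_le_sum fun i _ => ?_
          calc _ ≤ ∑ j, ((p.centreOut i (fun s => p.code (y (e.symm (.probe i s)))) j).length : ℝ)
                * D₂ := by
                refine Finset.sum_le_sum fun j _ => ?_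
                by_cases h : p.blk j = i
                · refine mul_le_mul ?_ (h ▸ h₂' j) dist_nonneg (by positivity)
                  simp only [hf, final]
                  split_ifs <;> simp
                · have : f (.inl (.centre i)) (.inr j) = [] := by simp [hf, final, h]
                  rw [this, List.length_nil, Nat.cast_zero, zero_mul]
                  positivity
            _ ≤ (W₂ : ℝ) * D₂ := by
                rw [← Finset.sum_mul]
                refine mul_le_mul_of_nonneg_right ?_ hD₂
                exact_mod_cast hcout i _
      _ = g * W₂ * D₂ := by simp [mul_assoc]
  rw [hsum]
  have hz : ∀ u v, f u v = [] → ((f u v).length : ℝ) * dist (pos u) (pos v) = 0 := fun u v h => by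
    simp [h]
  -- Only six kinds of links carry traffic.
  have hexp : ∑ u, ∑ v, ((f u v).length : ℝ) * dist (pos u) (pos v)
      = (∑ i, ((f (.inl .hub) (.inl (.centre i))).length : ℝ)
          * dist (pos (.inl .hub)) (pos (.inl (.centre i)))
        + ∑ s, ((f (.inl .hub) (.inl (.sensor s))).length : ℝ)
          * dist (pos (.inl .hub)) (pos (.inl (.sensor s)))
        + ∑ j, ((f (.inl .hub) (.inr j)).length : ℝ) * dist (pos (.inl .hub)) (pos (.inr j)))
        + ∑ i, ∑ j, ((f (.inl (.centre i)) (.inr j)).length : ℝ)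
          * dist (pos (.inl (.centre i))) (pos (.inr j))
        + ∑ s, ((f (.inl (.sensor s)) (.inl .hub)).length : ℝ)
          * dist (pos (.inl (.sensor s))) (pos (.inl .hub))
        + ∑ i, ∑ s, ∑ i', ((f (.inl (.probe i s)) (.inl (.centre i'))).length : ℝ)
          * dist (pos (.inl (.probe i s))) (pos (.inl (.centre i'))) := by
    have h1 : ∀ u v, f u v = [] → ((f u v).length : ℝ) * dist (pos u) (pos v) = 0 := hz
    simp only [Fintype.sum_sum_type, Role.sum_eq]
    have e1 : f (.inl .hub) (.inl .hub) = [] := rfl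
    have e2 : ∀ i s, f (.inl .hub) (.inl (.probe i s)) = [] := fun _ _ => rfl
    have e3 : ∀ s, f (.inl .hub) (.inl (.idle s)) = [] := fun _ => rfl
    have e4 : ∀ i u, f (.inl (.centre i)) (.inl u) = [] := fun _ u => by cases u <;> rfl
    have e5 : ∀ s i, f (.inl (.sensor s)) (.inl (.centre i)) = [] := fun _ _ => rfl
    have e6 : ∀ s i, f (.inl (.sensor s)) (.inl (.sensor i)) = [] := fun _ _ => rfl
    have e7 : ∀ s i t, f (.inl (.sensor s)) (.inl (.probe i t)) = [] := fun _ _ _ => rfl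
    have e8 : ∀ s i, f (.inl (.sensor s)) (.inl (.idle i)) = [] := fun _ _ => rfl
    have e9 : ∀ s j, f (.inl (.sensor s)) (.inr j) = [] := fun _ _ => rfl
    have e10 : ∀ i s, f (.inl (.probe i s)) (.inl .hub) = [] := fun _ _ => rfl
    have e11 : ∀ i s t, f (.inl (.probe i s)) (.inl (.sensor t)) = [] := fun _ _ _ => rfl
    have e12 : ∀ i s i' t, f (.inl (.probe i s)) (.inl (.probe i' t)) = [] := fun _ _ _ _ => rfl
    have e13 : ∀ i s t, f (.inl (.probe i s)) (.inl (.idle t)) = [] := fun _ _ _ => rfl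
    have e14 : ∀ i s j, f (.inl (.probe i s)) (.inr j) = [] := fun _ _ _ => rfl
    have e15 : ∀ s v, f (.inl (.idle s)) v = [] := fun _ v => by
      rcases v with (_ | _ | _ | _ | _) | _ <;> rfl
    have e16 : ∀ j v, f (.inr j) v = [] := fun _ v => by
      rcases v with (_ | _ | _ | _ | _) | _ <;> rfl
    simp only [e1, e2, e3, e4, e5, e6, e7, e8, e9, e10, e11, e12, e13, e14, e15, e16,
      List.length_nil, Nat.cast_zero, zero_mul, Finset.sum_const_zero, add_zero, zero_add]
    ring
  rw [hexp, hpad]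
  linarith

theorem le_bitMeters_circuit (s₀ : Fin a) (hs₀ : (s₀ : ℕ) = 0) (y : Fin m → ℂ) :
    p.pad * dist (pos (.inl .hub)) (pos (.inl (.sensor s₀)))
      ≤ (p.circuit e pos hinj hpos).bitMeters y := by
  have hpos' : ∀ u, (p.circuit e pos hinj hpos).pos ((label e).symm u) = pos u := fun u => by
    simp [circuit]
  rw [DecodingCircuit.bitMeters_eq]
  have h1 := Finset.single_le_sum (f := fun u => ∑ v,
    (((p.circuit e pos hinj hpos).message y u v).length : ℝ)
      * dist ((p.circuit e pos hinj hpos).pos u) ((p.circuit e pos hinj hpos).pos v))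
    (fun u _ => Finset.sum_nonneg fun v _ => by positivity)
    (Finset.mem_univ ((label e).symm (.inl .hub)))
  have h2 := Finset.single_le_sum (f := fun v =>
    (((p.circuit e pos hinj hpos).message y ((label e).symm (.inl .hub)) v).length : ℝ)
      * dist ((p.circuit e pos hinj hpos).pos ((label e).symm (.inl .hub)))
        ((p.circuit e pos hinj hpos).pos v))
    (fun v _ => by positivity) (Finset.mem_univ ((label e).symm (.inl (.sensor s₀))))
  refine le_trans (le_of_eq ?_) (h2.trans h1)
  simp only [message_circuit, hpos', final, hs₀, if_true, List.length_replicate]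

end Protocol

/-! ### Placing the nodes on the lattice -/

theorem Nat.eq_of_mul_add_eq_mul_add {S x y x' y' : ℕ} (hy : y < S) (hy' : y' < S)
    (h : x * S + y = x' * S + y') : x = x' ∧ y = y' := by
  have hS : 0 < S := by omega
  have h1 : (x * S + y) / S = x := by
    rw [Nat.add_comm, Nat.add_mul_div_right _ _ hS, Nat.div_eq_of_lt hy, Nat.zero_add]
  have h2 : (x' * S + y') / S = x' := by
    rw [Nat.add_comm, Nat.add_mul_div_right _ _ hS, Nat.div_eq_of_lt hy', Nat.zero_add]
  have hx : x = x' := by rw [← h1, h, h2]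
  subst hx
  exact ⟨rfl, by omega⟩

/-- The `s`-th place of the cluster around the hub, a square of side `R`. -/
def clusterPoint (R s : ℕ) : ℤ × ℤ := (-1 - ((s % R : ℕ) : ℤ), -1 - ((s / R : ℕ) : ℤ))

/-- The `s`-th place of the `i`-th cell, in a square array of `G ^ 2` cells of side `S`. -/
def cellPoint (G S i s : ℕ) : ℤ × ℤ :=
  (((i % G * S + s % S : ℕ) : ℤ), ((i / G * S + s / S : ℕ) : ℤ))

theorem clusterPoint_injective (R : ℕ) : Function.Injective (clusterPoint R) := by
  intro s t h
  simp only [clusterPoint, Prod.mk.injEq] at h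
  have h1 : s % R = t % R := by omega
  have h2 : s / R = t / R := by omega
  rw [← Nat.div_add_mod s R, ← Nat.div_add_mod t R, h1, h2]

theorem cellPoint_inj {G S i s i' s' : ℕ} (hs : s < S * S) (hs' : s' < S * S)
    (h : cellPoint G S i s = cellPoint G S i' s') : i = i' ∧ s = s' := by
  simp only [cellPoint, Prod.mk.injEq, Nat.cast_inj] at h
  have hS : 0 < S := Nat.pos_of_ne_zero (by rintro rfl; omega)
  obtain ⟨h1, h2⟩ := Nat.eq_of_mul_add_eq_mul_add (Nat.mod_lt s hS) (Nat.mod_lt s' hS) h.1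
  obtain ⟨h3, h4⟩ := Nat.eq_of_mul_add_eq_mul_add (Nat.div_lt_of_lt_mul hs)
    (Nat.div_lt_of_lt_mul hs') h.2
  constructor
  · rw [← Nat.div_add_mod i G, ← Nat.div_add_mod i' G, h1, h3]
  · rw [← Nat.div_add_mod s S, ← Nat.div_add_mod s' S, h2, h4]

/-- The places of the nodes of a two-level decoder. -/
def place (G R S g a b r n : ℕ) : Role g a b r ⊕ Fin n → ℤ × ℤ
  | .inl .hub => clusterPoint R 0
  | .inl (.sensor s) => clusterPoint R (s + 1)
  | .inl (.centre i) => cellPoint G S i 0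
  | .inl (.probe i s) => cellPoint G S i (s + 1)
  | .inl (.idle s) => (-1 - ((s : ℕ) : ℤ), 0)
  | .inr j => cellPoint G S ((j : ℕ) % g) (b + 1 + (j : ℕ) / g)

theorem clusterPoint_neg (R s : ℕ) : (clusterPoint R s).2 < 0 := by
  have := Nat.zero_le (s / R)
  simp only [clusterPoint]; omega

theorem cellPoint_nonneg (G S i s : ℕ) : 0 ≤ (cellPoint G S i s).1 ∧ 0 ≤ (cellPoint G S i s).2 := by
  exact ⟨Int.natCast_nonneg _, Int.natCast_nonneg _⟩

/-- The cluster has negative second coordinates, the cells fill part of the closed first quadrant,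
and the idle nodes sit on the negative first axis. In a cell, place `0` is the centre, `1, …, b` are
the probes and the rest are output-nodes, where `j` is determined by `j % g` and `j / g`. -/
theorem place_injective {G R S g a b r n : ℕ} (hS : b + 1 + n / g < S * S) :
    Function.Injective (place G R S g a b r n) := by
  have hj : ∀ j : Fin n, b + 1 + (j : ℕ) / g < S * S := fun j =>
    lt_of_le_of_lt (Nat.add_le_add_left (Nat.div_le_div_right j.2.le) _) hS
  have hb : ∀ s : Fin b, (s : ℕ) + 1 < S * S := fun s => by
    have := s.2
    have := Nat.zero_le (n / g)
    omega
  have h0 : 0 < S * S := by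
    have := Nat.zero_le (n / g)
    omega
  have hcc : ∀ s i t, clusterPoint R s ≠ cellPoint G S i t := fun s i t h => by
    have h1 := clusterPoint_neg R s
    have h2 := (cellPoint_nonneg G S i t).2
    rw [h] at h1; omega
  have hci : ∀ (s t : ℕ), clusterPoint R s ≠ (-1 - (t : ℤ), 0) := fun s t h => by
    have h1 := clusterPoint_neg R s
    rw [h] at h1; simp at h1
  have hei : ∀ (i s t : ℕ), cellPoint G S i s ≠ (-1 - (t : ℤ), 0) := fun i s t h => by
    have h1 := (cellPoint_nonneg G S i s).1
    rw [h] at h1; simp only at h1; omega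
  rintro ((_ | i | s | ⟨i, s⟩ | s) | j) ((_ | i' | s' | ⟨i', s'⟩ | s') | j') h <;>
    simp only [place] at h
  all_goals first
    | rfl
    | exact absurd h (hcc _ _ _)
    | exact absurd h.symm (hcc _ _ _)
    | exact absurd h (hci _ _)
    | exact absurd h.symm (hci _ _)
    | exact absurd h (hei _ _ _)
    | exact absurd h.symm (hei _ _ _)
    | skip
  · have := clusterPoint_injective R h; omega
  · rw [Fin.ext (cellPoint_inj h0 h0 h).1]
  · have := (cellPoint_inj h0 (hb _) h).2; omega
  · have := (cellPoint_inj h0 (hj _) h).2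
    have := Nat.zero_le ((j' : ℕ) / g)
    omega
  · have := clusterPoint_injective R h; omega
  · have := clusterPoint_injective R h
    rw [Fin.ext (Nat.succ_injective this)]
  · have := (cellPoint_inj (hb _) h0 h).2; omega
  · have := cellPoint_inj (hb _) (hb _) h
    rw [Fin.ext this.1, Fin.ext (Nat.succ_injective this.2)]
  · have := (cellPoint_inj (hb _) (hj _) h).2
    have := s.2
    have := Nat.zero_le ((j' : ℕ) / g)
    omega
  · simp only [Prod.mk.injEq] at h
    have : s = s' := Fin.ext (by omega)
    rw [this]
  · have := (cellPoint_inj (hj _) h0 h).2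
    have := Nat.zero_le ((j : ℕ) / g)
    omega
  · have := (cellPoint_inj (hj _) (hb _) h).2
    have := s'.2
    have := Nat.zero_le ((j : ℕ) / g)
    omega
  · have := cellPoint_inj (hj _) (hj _) h
    have h2 : (j : ℕ) / g = (j' : ℕ) / g := by omega
    have : j = j' := Fin.ext (by
      rw [← Nat.div_add_mod j g, ← Nat.div_add_mod j' g, this.1, h2])
    rw [this]

/-- The nodes of two-level decoders can be placed on `Λ`, in a cluster of side `R` around the hub
and a square array of cells of side `S`, with all distances of the expected order. -/
def HasLayouts (Λ : Submodule ℤ Plane) (B : ℝ) : Prop :=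
  ∀ (G R S g a b r n : ℕ), a < R * R → b + 1 + n / g < S * S → g ≤ G * G →
      0 < g → ∃ pos : Role g a b r ⊕ Fin n → Plane, Function.Injective pos ∧ (∀ u, pos u ∈ Λ) ∧
        (∀ s, dist (pos (.inl (.sensor s))) (pos (.inl .hub)) ≤ 2 * B * R) ∧
        (∀ i s, dist (pos (.inl (.probe i s))) (pos (.inl (.centre i))) ≤ 2 * B * S) ∧
        (∀ (i : Fin g) (j : Fin n), (j : ℕ) % g = i → dist (pos (.inl (.centre i))) (pos (.inr j)) ≤ 2 * B * S) ∧
        (∀ i, dist (pos (.inl .hub)) (pos (.inl (.centre i))) ≤ 2 * B * (G * S + R)) ∧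
        (∀ j, dist (pos (.inl .hub)) (pos (.inr j)) ≤ 2 * B * (G * S + R))

/-- The idle nodes may be arbitrarily far away, because they are silent; no distance to them is
controlled. -/
theorem exists_hasLayouts (Λ : Submodule ℤ Plane) [DiscreteTopology Λ] [IsZLattice ℝ Λ] :
    ∃ B : ℝ, 1 ≤ B ∧ HasLayouts Λ B := by
  obtain ⟨φ, B, hB, hφ, hΛ, hd⟩ := exists_lattice_embedding Λ
  refine ⟨B, hB, fun G R S g a b r n hR hS hG hg => ⟨φ ∘ place G R S g a b r n,
    hφ.comp (place_injective hS), fun u => hΛ _, ?_⟩⟩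
  have hdist : ∀ (p q : ℤ × ℤ) (L : ℝ), |(p.1 : ℝ) - q.1| ≤ L → |(p.2 : ℝ) - q.2| ≤ L →
      dist (φ p) (φ q) ≤ 2 * B * L := fun p q L h1 h2 => by
    refine (hd p q).trans ?_
    nlinarith
  have hS0 : 0 < S := Nat.pos_of_ne_zero (by
    rintro rfl
    simp at hS)
  have hR0 : 0 < R := Nat.pos_of_ne_zero (by rintro rfl; omega)
  have hG0 : 0 < G := Nat.pos_of_ne_zero (by rintro rfl; omega)
  have hj : ∀ j : Fin n, b + 1 + (j : ℕ) / g < S * S := fun j =>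
    lt_of_le_of_lt (Nat.add_le_add_left (Nat.div_le_div_right j.2.le) _) hS
  have hb : ∀ s : Fin b, (s : ℕ) + 1 < S * S := fun s => by
    have := s.2
    have := Nat.zero_le (n / g)
    omega
  have h0 : 0 < S * S := by
    have := Nat.zero_le (n / g)
    omega
  have hcell : ∀ i s t, s < S * S → t < S * S →
      dist (φ (cellPoint G S i s)) (φ (cellPoint G S i t)) ≤ 2 * B * S := by
    intro i s t hs ht
    have a1 : ((s % S : ℕ) : ℝ) ≤ S := by exact_mod_cast (Nat.mod_lt s hS0).le
    have a2 : ((t % S : ℕ) : ℝ) ≤ S := by exact_mod_cast (Nat.mod_lt t hS0).le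
    have a3 : ((s / S : ℕ) : ℝ) ≤ S := by exact_mod_cast (Nat.div_lt_of_lt_mul hs).le
    have a4 : ((t / S : ℕ) : ℝ) ≤ S := by exact_mod_cast (Nat.div_lt_of_lt_mul ht).le
    have b1 : (0 : ℝ) ≤ ((s % S : ℕ) : ℝ) := Nat.cast_nonneg _
    have b2 : (0 : ℝ) ≤ ((t % S : ℕ) : ℝ) := Nat.cast_nonneg _
    have b3 : (0 : ℝ) ≤ ((s / S : ℕ) : ℝ) := Nat.cast_nonneg _
    have b4 : (0 : ℝ) ≤ ((t / S : ℕ) : ℝ) := Nat.cast_nonneg _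
    refine hdist _ _ _ ?_ ?_
    · simp only [cellPoint, Int.cast_natCast]
      rw [Nat.cast_add, Nat.cast_add, abs_le]
      constructor <;> linarith
    · simp only [cellPoint, Int.cast_natCast]
      rw [Nat.cast_add, Nat.cast_add, abs_le]
      constructor <;> linarith
  have hfar : ∀ i t, i < g → t < S * S →
      dist (φ (clusterPoint R 0)) (φ (cellPoint G S i t)) ≤ 2 * B * (G * S + R) := by
    intro i t hi ht
    have a1 : i % G * S + t % S ≤ G * S := by
      have h1 := Nat.mod_lt i hG0
      have h2 := Nat.mod_lt t hS0
      calc i % G * S + t % S ≤ (i % G + 1) * S := by rw [add_mul, one_mul]; omega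
        _ ≤ G * S := Nat.mul_le_mul_right _ h1
    have a2 : i / G * S + t / S ≤ G * S := by
      have h1 : i / G < G := Nat.div_lt_of_lt_mul (by omega)
      have h2 : t / S < S := Nat.div_lt_of_lt_mul ht
      calc i / G * S + t / S ≤ (i / G + 1) * S := by rw [add_mul, one_mul]; omega
        _ ≤ G * S := Nat.mul_le_mul_right _ h1
    have a1' : ((i % G * S + t % S : ℕ) : ℝ) ≤ G * S := by exact_mod_cast a1
    have a2' : ((i / G * S + t / S : ℕ) : ℝ) ≤ G * S := by exact_mod_cast a2
    have b1 : (0 : ℝ) ≤ ((i % G * S + t % S : ℕ) : ℝ) := Nat.cast_nonneg _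
    have b2 : (0 : ℝ) ≤ ((i / G * S + t / S : ℕ) : ℝ) := Nat.cast_nonneg _
    have hR1 : (1 : ℝ) ≤ R := by exact_mod_cast hR0
    refine hdist _ _ _ ?_ ?_
    · simp only [cellPoint, clusterPoint, Int.cast_natCast, Nat.zero_mod, Nat.zero_div,
        Nat.cast_zero, sub_zero, Int.cast_neg, Int.cast_one]
      rw [abs_le]
      constructor <;> linarith
    · simp only [cellPoint, clusterPoint, Int.cast_natCast, Nat.zero_mod, Nat.zero_div,
        Nat.cast_zero, sub_zero, Int.cast_neg, Int.cast_one]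
      rw [abs_le]
      constructor <;> linarith
  refine ⟨fun s => ?_, fun i s => ?_, fun i j hij => ?_, fun i => ?_, fun j => ?_⟩
  · have a1 : (((s + 1 : ℕ) % R : ℕ) : ℝ) ≤ R := by exact_mod_cast (Nat.mod_lt _ hR0).le
    have a2 : (((s + 1 : ℕ) / R : ℕ) : ℝ) ≤ R := by
      have : (s : ℕ) + 1 < R * R := lt_of_le_of_lt s.2 hR
      exact_mod_cast (Nat.div_lt_of_lt_mul this).le
    have b1 : (0 : ℝ) ≤ (((s + 1 : ℕ) % R : ℕ) : ℝ) := Nat.cast_nonneg _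
    have b2 : (0 : ℝ) ≤ (((s + 1 : ℕ) / R : ℕ) : ℝ) := Nat.cast_nonneg _
    refine hdist _ _ _ ?_ ?_
    · simp only [place, clusterPoint, Int.cast_natCast, Nat.zero_mod, Nat.zero_div,
        Nat.cast_zero, sub_zero, Int.cast_neg, Int.cast_one, Int.cast_sub]
      rw [abs_le]
      constructor <;> linarith
    · simp only [place, clusterPoint, Int.cast_natCast, Nat.zero_mod, Nat.zero_div,
        Nat.cast_zero, sub_zero, Int.cast_neg, Int.cast_one, Int.cast_sub]
      rw [abs_le]
      constructor <;> linarith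
  · exact hcell i (s + 1) 0 (hb s) h0
  · have := hcell i 0 (b + 1 + (j : ℕ) / g) h0 (hj j)
    rw [← hij] at this
    simp only [Function.comp_apply, place, ← hij]
    exact this
  · exact hfar i 0 i.2 h0
  · exact hfar ((j : ℕ) % g) (b + 1 + (j : ℕ) / g) (Nat.mod_lt _ hg) (hj j)


/-! ### Sparse decoding -/

/-- The rows of `A` bound every difference of `s`-sparse vectors, with constant `N`. -/
def IsRobust {m n : ℕ} (A : Fin m → Fin n → ℕ) (s : ℕ) (N : ℝ) : Prop :=
  ∀ w : Fin n → ℝ, (Finset.univ.filter fun j => w j ≠ 0).card ≤ 2 * s → ∀ ε : ℝ,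
    (∀ i, |∑ j, (A i j : ℝ) * w j| ≤ ε) → ∀ j, |w j| ≤ N * ε

/-- `z` is an `s`-sparse vector bounded by `U` that explains the measurements `y` up to `θ`. -/
def IsExplanation {m n : ℕ} (A : Fin m → Fin n → ℕ) (s : ℕ) (U θ : ℝ) (y : Fin m → ℝ)
    (z : Fin n → ℝ) : Prop :=
  (Finset.univ.filter fun j => z j ≠ 0).card ≤ s ∧ (∀ j, |z j| ≤ U) ∧
    ∀ i, |∑ j, (A i j : ℝ) * z j - y i| ≤ θ

open Classical in
/-- Some explanation of the measurements `y`, or `0` if there is none. -/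
def decode {m n : ℕ} (A : Fin m → Fin n → ℕ) (s : ℕ) (U θ : ℝ) (y : Fin m → ℝ) : Fin n → ℝ :=
  if h : ∃ z, IsExplanation A s U θ y z then h.choose else 0

section decode

variable {m n : ℕ} {A : Fin m → Fin n → ℕ} {s : ℕ} {U θ : ℝ} {y : Fin m → ℝ}

theorem card_decode_le : (Finset.univ.filter fun j => decode A s U θ y j ≠ 0).card ≤ s := by
  unfold decode
  split_ifs with h
  · exact h.choose_spec.1
  · simp

theorem abs_decode_le (hU : 0 ≤ U) (j : Fin n) : |decode A s U θ y j| ≤ U := by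
  unfold decode
  split_ifs with h
  · exact h.choose_spec.2.1 j
  · simpa using hU

/-- The decoded vector and `x` are both explanations, so their difference has at most `2 s` non-zero
entries and measurements of size at most `2 θ`. -/
theorem abs_decode_sub_le {N : ℝ} (hA : IsRobust A s N) {x : Fin n → ℝ}
    (hx : IsExplanation A s U θ y x) (j : Fin n) : |decode A s U θ y j - x j| ≤ N * (2 * θ) := by
  have h : ∃ z, IsExplanation A s U θ y z := ⟨x, hx⟩
  have hz : IsExplanation A s U θ y (decode A s U θ y) := by
    unfold decode
    rw [dif_pos h]
    exact h.choose_spec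
  refine hA (fun j => decode A s U θ y j - x j) ?_ (2 * θ) (fun i => ?_) j
  · calc _ ≤ ((Finset.univ.filter fun j => decode A s U θ y j ≠ 0)
          ∪ (Finset.univ.filter fun j => x j ≠ 0)).card := by
          refine Finset.card_le_card fun j hj => ?_
          simp only [Finset.mem_union, Finset.mem_filter, Finset.mem_univ, true_and] at hj ⊢
          by_contra! hc
          exact hj (by rw [hc.1, hc.2, sub_zero])
      _ ≤ _ := Finset.card_union_le _ _
      _ ≤ 2 * s := by
          have h1 := hz.1
          have h2 := hx.1
          omega
  · have h1 := abs_le.1 (hz.2.2 i)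
    have h2 := abs_le.1 (hx.2.2 i)
    have : ∑ j, (A i j : ℝ) * (decode A s U θ y j - x j)
        = ∑ j, (A i j : ℝ) * decode A s U θ y j - ∑ j, (A i j : ℝ) * x j := by
      rw [← Finset.sum_sub_distrib]
      exact Finset.sum_congr rfl fun j _ => mul_sub _ _ _
    rw [this, abs_le]
    constructor <;> linarith

end decode

/-! ### Quantization -/

/-- The number with a given binary expansion. -/
def natOfBits (w : List Bool) : ℕ := w.foldr Nat.bit 0

theorem natOfBits_bits (q : ℕ) : natOfBits q.bits = q := by
  induction q using Nat.binaryRec' with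
  | zero => rfl
  | bit b q h ih =>
    rw [Nat.bits_append_bit q b h]
    simpa [natOfBits] using congrArg (Nat.bit b) ih

/-- Binary report of a number in `[-Y, Y]`, in steps of `η`. -/
def report (Y η : ℝ) (z : ℂ) : List Bool := Nat.bits ⌊(z.re + Y) / η⌋₊

/-- The number that a report stands for. -/
def readReport (Y η : ℝ) (w : List Bool) : ℝ := natOfBits w * η - Y

theorem abs_readReport_sub_le {Y η v : ℝ} (hη : 0 < η) (hv : |v| ≤ Y) :
    |readReport Y η (report Y η (v : ℂ)) - v| ≤ η := by
  have h0 : 0 ≤ (v + Y) / η := div_nonneg (by linarith [abs_le.1 hv]) hη.le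
  have h1 := Nat.floor_le h0
  have h2 := Nat.lt_floor_add_one ((v + Y) / η)
  rw [le_div_iff₀ hη] at h1
  rw [div_lt_iff₀ hη] at h2
  rw [readReport, report, natOfBits_bits, Complex.ofReal_re, abs_le]
  constructor <;> linarith

theorem length_report_le {Y η : ℝ} {β : ℕ} {z : ℂ} (hη : 0 < η) (hz : |z.re| ≤ Y)
    (hβ : 2 * Y / η < 2 ^ β) : (report Y η z).length ≤ β := by
  rw [report, Nat.size_eq_bits_len, Nat.size_le]
  rw [Nat.floor_lt (div_nonneg (by linarith [abs_le.1 hz]) hη.le)]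
  push_cast
  refine lt_of_le_of_lt ?_ hβ
  gcongr
  linarith [abs_le.1 hz]

theorem measurableSet_report (Y η : ℝ) (S : Set (List Bool)) :
    MeasurableSet {z | report Y η z ∈ S} := by
  have : Measurable fun z : ℂ => ⌊(z.re + Y) / η⌋₊ :=
    Nat.measurable_floor.comp ((Complex.measurable_re.add_const Y).div_const η)
  exact this (t := {q | Nat.bits q ∈ S}) (MeasurableSet.of_discrete)

/-- Unary address with a number in `[-U, U]`, in steps of `δ`; it is never empty. -/
def address (U δ v : ℝ) : List Bool := List.replicate (⌊(v + U) / δ⌋₊ + 1) true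

/-- The number that an address of length `l` stands for. -/
def readAddress (U δ : ℝ) (l : ℕ) : ℝ := if l = 0 then 0 else ((l - 1 : ℕ) : ℝ) * δ - U

theorem abs_readAddress_sub_le {U δ v : ℝ} (hδ : 0 < δ) (hv : |v| ≤ U) :
    |readAddress U δ (address U δ v).length - v| ≤ δ := by
  have h0 : 0 ≤ (v + U) / δ := div_nonneg (by linarith [abs_le.1 hv]) hδ.le
  have h1 := Nat.floor_le h0
  have h2 := Nat.lt_floor_add_one ((v + U) / δ)
  rw [le_div_iff₀ hδ] at h1
  rw [div_lt_iff₀ hδ] at h2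
  rw [readAddress, address, List.length_replicate, if_neg (Nat.succ_ne_zero _),
    Nat.add_sub_cancel, abs_le]
  constructor <;> linarith

theorem length_address_le {U δ v : ℝ} (hδ : 0 < δ) (hv : |v| ≤ U) :
    (address U δ v).length ≤ ⌊2 * U / δ⌋₊ + 1 := by
  rw [address, List.length_replicate]
  gcongr
  linarith [abs_le.1 hv]

/-! ### The decoder -/

/-- The entries that the hub detects. -/
def detected {a n : ℕ} (A : Fin a → Fin n → ℕ) (k : ℕ) (U Y η κ : ℝ) (h : Fin a → List Bool) :
    Finset (Fin n) :=
  Finset.univ.filter fun j => κ < |decode A k U η (fun s => readReport Y η (h s)) j|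

/-- The parameters of the two-level decoder. -/
structure DecoderData (g a b n : ℕ) where
  A : Fin a → Fin n → ℕ
  A' : Fin b → Fin n → ℕ
  blk : Fin n → Fin g
  k : ℕ
  cap : ℕ
  U : ℝ
  Y : ℝ
  η : ℝ
  κ : ℝ
  θ : ℝ
  δ : ℝ
  N : ℝ

/-- The relations between the parameters under which the two-level decoder succeeds. -/
structure DecoderData.Valid {g a b n : ℕ} (d : DecoderData g a b n) : Prop where
  A_le : ∀ s j, d.A s j ≤ n
  A'_le : ∀ s j, d.A' s j ≤ n
  robust : IsRobust d.A d.k d.N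
  robust' : IsRobust d.A' d.cap d.N
  U_nonneg : 0 ≤ d.U
  η_pos : 0 < d.η
  δ_pos : 0 < d.δ
  Y_eq : d.Y = n * n * d.U
  κ_eq : d.κ = d.N * (2 * d.η)
  θ_eq : d.θ = d.η + n * n * (2 * d.κ)
  le_δ : d.N * (2 * d.θ) ≤ d.δ
  κ_nonneg : 0 ≤ d.κ
  κ_le : d.κ ≤ d.δ

namespace DecoderData

variable {g a b n : ℕ} (d : DecoderData g a b n)

open Classical in
/-- The two-level decoder. The hub serves the entries in overloaded blocks, unless there are `g` or
more of them, and the centres serve the other blocks. -/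
def protocol (pad : ℕ) : Protocol g a b n where
  pad := pad
  code := report d.Y d.η
  measurableSet_code := measurableSet_report d.Y d.η
  blk := d.blk
  go h i := if (overload d.blk d.cap (detected d.A d.k d.U d.Y d.η d.κ h)).card < g ∧
      i ∉ (overload d.blk d.cap (detected d.A d.k d.U d.Y d.η d.κ h)).image d.blk
    then [true] else []
  hubOut h j := if (overload d.blk d.cap (detected d.A d.k d.U d.Y d.η d.κ h)).card < g ∧
      j ∈ overload d.blk d.cap (detected d.A d.k d.U d.Y d.η d.κ h)
    then address d.U d.δ (decode d.A d.k d.U d.η (fun s => readReport d.Y d.η (h s)) j) else []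
  centreOut _ h j := if d.δ < |decode d.A' d.cap d.U d.θ (fun s => readReport d.Y d.η (h s)) j|
    then address d.U d.δ (decode d.A' d.cap d.U d.θ (fun s => readReport d.Y d.η (h s)) j) else []
  value := readAddress d.U d.δ
  value_zero := by simp [readAddress]

/-- The value declared by an output-node. -/
def output {r : ℕ} (y : Role g a b r → ℂ) (j : Fin n) : ℝ :=
  readAddress d.U d.δ (((d.protocol 0).final y (.inl .hub) (.inr j)).length
    + ((d.protocol 0).final y (.inl (.centre (d.blk j))) (.inr j)).length)

theorem output_of_hub_eq_zero {r : ℕ} (y : Role g a b r → ℂ) (hy : y .hub = 0) (j : Fin n) :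
    d.output y j = 0 := by
  simp [output, Protocol.final, hy, readAddress]

variable {d}

theorem length_go_le (pad : ℕ) (h : Fin a → List Bool) (i : Fin g) :
    ((d.protocol pad).go h i).length ≤ 1 := by
  simp only [protocol]
  split_ifs <;> simp

/-- The bound holds for arbitrary reports, because the hub itself falls silent when it would have to
serve `g` or more entries. This makes the cost bound a worst-case one. -/
theorem sum_length_hubOut_le (hd : d.Valid) (pad : ℕ) (h : Fin a → List Bool) :
    ∑ j, ((d.protocol pad).hubOut h j).length ≤ g * (⌊2 * d.U / d.δ⌋₊ + 1) := by
  classical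
  simp only [protocol]
  by_cases hc : (overload d.blk d.cap (detected d.A d.k d.U d.Y d.η d.κ h)).card < g
  · calc _ ≤ ∑ j, if j ∈ overload d.blk d.cap (detected d.A d.k d.U d.Y d.η d.κ h) then
          (⌊2 * d.U / d.δ⌋₊ + 1) else 0 := by
          refine Finset.sum_le_sum fun j _ => ?_
          split_ifs with h1 h2 h2
          · exact length_address_le hd.δ_pos (abs_decode_le hd.U_nonneg j)
          · exact absurd h1.2 h2
          · exact Nat.zero_le _
          · exact le_rfl
      _ = (overload d.blk d.cap (detected d.A d.k d.U d.Y d.η d.κ h)).card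
          * (⌊2 * d.U / d.δ⌋₊ + 1) := by
          rw [← Finset.sum_filter, Finset.sum_const, smul_eq_mul]
          congr 2
          ext j; simp
      _ ≤ _ := Nat.mul_le_mul_right _ hc.le
  · simp [hc]

theorem sum_length_centreOut_le (hd : d.Valid) (pad : ℕ) (i : Fin g) (h : Fin b → List Bool) :
    ∑ j, ((d.protocol pad).centreOut i h j).length ≤ d.cap * (⌊2 * d.U / d.δ⌋₊ + 1) := by
  classical
  simp only [protocol]
  calc _ ≤ ∑ j, if decode d.A' d.cap d.U d.θ (fun s => readReport d.Y d.η (h s)) j ≠ 0 then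
        (⌊2 * d.U / d.δ⌋₊ + 1) else 0 := by
        refine Finset.sum_le_sum fun j _ => ?_
        split_ifs with h1 h2 h2
        · exact length_address_le hd.δ_pos (abs_decode_le hd.U_nonneg j)
        · push Not at h2
          rw [h2, abs_zero] at h1
          exact absurd h1 (not_lt.2 hd.δ_pos.le)
        · exact Nat.zero_le _
        · exact le_rfl
    _ = (Finset.univ.filter fun j =>
          decode d.A' d.cap d.U d.θ (fun s => readReport d.Y d.η (h s)) j ≠ 0).card
        * (⌊2 * d.U / d.δ⌋₊ + 1) := by
        rw [← Finset.sum_filter, Finset.sum_const, smul_eq_mul]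
    _ ≤ _ := Nat.mul_le_mul_right _ card_decode_le

theorem abs_sum_mul_le {m : ℕ} {A : Fin m → Fin n → ℕ} (hA : ∀ s j, A s j ≤ n) {x : Fin n → ℝ}
    {V : ℝ} (hx : ∀ j, |x j| ≤ V) (s : Fin m) : |∑ j, (A s j : ℝ) * x j| ≤ n * n * V := by
  calc _ ≤ ∑ j, |(A s j : ℝ) * x j| := Finset.abs_sum_le_sum_abs _ _
    _ ≤ ∑ _j : Fin n, (n : ℝ) * V := by
        refine Finset.sum_le_sum fun j _ => ?_
        rw [abs_mul, Nat.abs_cast]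
        exact mul_le_mul (Nat.cast_le.2 (hA s j)) (hx j) (abs_nonneg _) (by positivity)
    _ = n * n * V := by simp [mul_assoc]

/-- The entries of `x` may be arbitrarily small, so the support itself cannot be recovered. The hub
knows `x` up to `κ`; the set `D` of entries that it sees above `κ` lies in the support and misses
only entries of size at most `2 κ`. Blocks are judged by `D`, and a centre treats the missed entries
as noise, which is the second term of `θ`. Exact zeros are always declared `0`, which keeps the
error `k`-sparse. -/
theorem output_spec (hd : d.Valid) {r : ℕ} {x : Fin n → ℝ}
    (hk : (Finset.univ.filter fun j => x j ≠ 0).card ≤ d.k) (hx : ∀ j, |x j| ≤ d.U)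
    {y : Role g a b r → ℂ} (hhub : y .hub ≠ 0)
    (hsens : ∀ s, y (.sensor s) = ((∑ j, (d.A s j : ℝ) * x j : ℝ) : ℂ))
    (hprobe : ∀ i s, y (.probe i s)
      = ((∑ j, (d.A' s j : ℝ) * (if d.blk j = i then x j else 0) : ℝ) : ℂ))
    (hover : (overload d.blk d.cap (Finset.univ.filter fun j => x j ≠ 0)).card < g) (j : Fin n) :
    (x j = 0 → d.output y j = 0) ∧ |x j - d.output y j| ≤ 3 * d.δ := by
  classical
  set h : Fin a → List Bool := fun s => report d.Y d.η (y (.sensor s)) with hh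
  set z := decode d.A d.k d.U d.η (fun s => readReport d.Y d.η (h s)) with hz
  set D := detected d.A d.k d.U d.Y d.η d.κ h with hD
  have hzx : ∀ j, |z j - x j| ≤ d.κ := fun j => by
    rw [hd.κ_eq]
    refine abs_decode_sub_le hd.robust ⟨hk, hx, fun s => ?_⟩ j
    rw [abs_sub_comm, hh]
    simp only [hsens]
    exact abs_readReport_sub_le hd.η_pos (by rw [hd.Y_eq]; exact abs_sum_mul_le hd.A_le hx s)
  have hDmem : ∀ j, j ∈ D ↔ d.κ < |z j| := fun j => by
    simp [hD, detected, hz]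
  have hDx : ∀ j, j ∈ D → x j ≠ 0 := fun j hj h0 => by
    have h1 := hzx j
    rw [h0, sub_zero] at h1
    exact absurd ((hDmem j).1 hj) (not_lt.2 h1)
  have hnD : ∀ j, j ∉ D → |x j| ≤ 2 * d.κ := fun j hj => by
    rw [hDmem, not_lt] at hj
    have h1 := abs_le.1 hj
    have h2 := abs_le.1 (hzx j)
    rw [abs_le]
    constructor <;> linarith
  have hDsub : D ⊆ Finset.univ.filter fun j => x j ≠ 0 := fun j hj => by
    simpa using hDx j hj
  have hT : (overload d.blk d.cap D).card < g :=
    lt_of_le_of_lt (Finset.card_le_card (overload_mono _ _ hDsub)) hover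
  have hhubf : (d.protocol 0).final y (.inl .hub) (.inr j)
      = if j ∈ overload d.blk d.cap D then address d.U d.δ (z j) else [] := by
    simp only [Protocol.final, protocol, if_neg hhub, ← hh, ← hD, ← hz, hT, true_and]
  by_cases hblk : d.blk j ∈ (overload d.blk d.cap D).image d.blk
  · have hcf : (d.protocol 0).final y (.inl (.centre (d.blk j))) (.inr j) = [] := by
      simp only [Protocol.final, protocol, if_neg hhub, ← hh, ← hD, hT, hblk,
        not_true_eq_false, if_false, ne_eq, and_false]
    -- In a crowded block every detected entry is served by the hub, so the centre can stay silent
    -- and no output-node hears two addresses.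
    have hiff : j ∈ overload d.blk d.cap D ↔ j ∈ D := by
      obtain ⟨i, hi, hij⟩ := Finset.mem_image.1 hblk
      rw [overload, Finset.mem_filter] at hi ⊢
      rw [hij] at hi
      exact ⟨fun h => h.1, fun h => ⟨h, hi.2⟩⟩
    rw [output, hhubf, hcf]
    by_cases hj : j ∈ D
    · rw [if_pos (hiff.2 hj), List.length_nil, add_zero]
      refine ⟨fun h0 => absurd h0 (hDx j hj), ?_⟩
      have h1 := abs_le.1 (abs_readAddress_sub_le (v := z j) hd.δ_pos (abs_decode_le hd.U_nonneg j))
      have h2 := abs_le.1 (hzx j)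
      have := hd.κ_le
      have := hd.δ_pos
      rw [abs_le]
      constructor <;> linarith
    · rw [if_neg (fun h => hj (hiff.1 h))]
      simp only [List.length_nil, add_zero, readAddress, if_true, sub_zero, implies_true, true_and]
      have := hnD j hj
      have := hd.κ_le
      have := hd.δ_pos
      linarith
  · have hnot : j ∉ overload d.blk d.cap D := fun h => hblk (Finset.mem_image_of_mem _ h)
    -- The part of `x` that the centre is meant to find: it is `cap`-sparse, whereas the whole block
    -- of `x` need not be.
    set σ : Fin n → ℝ := fun i => if d.blk i = d.blk j ∧ i ∈ D then x i else 0 with hσ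
    set h' : Fin b → List Bool := fun s => report d.Y d.η (y (.probe (d.blk j) s)) with hh'
    set z' := decode d.A' d.cap d.U d.θ (fun s => readReport d.Y d.η (h' s)) with hz'
    have hcf : (d.protocol 0).final y (.inl (.centre (d.blk j))) (.inr j)
        = if d.δ < |z' j| then address d.U d.δ (z' j) else [] := by
      have : (d.protocol 0).blk j = d.blk j := rfl
      simp only [Protocol.final, this, true_and]
      rw [if_pos]
      · rfl
      · simp only [protocol, if_neg hhub, ← hh, ← hD, hT, true_and, hblk, not_false_eq_true,
          if_true, ne_eq, List.cons_ne_self]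
    have hcap : (D.filter fun i => d.blk i = d.blk j).card ≤ d.cap := by
      rcases (D.filter fun i => d.blk i = d.blk j).eq_empty_or_nonempty with he | ⟨i, hi⟩
      · simp [he]
      · rw [Finset.mem_filter] at hi
        by_contra! hlt
        refine hblk (Finset.mem_image.2 ⟨i, ?_, hi.2⟩)
        rw [overload, Finset.mem_filter, hi.2]
        exact ⟨hi.1, hlt⟩
    have hexpl : IsExplanation d.A' d.cap d.U d.θ (fun s => readReport d.Y d.η (h' s)) σ := by
      refine ⟨(Finset.card_le_card fun i hi => ?_).trans hcap, fun i => ?_, fun s => ?_⟩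
      · simp only [hσ, Finset.mem_filter, Finset.mem_univ, true_and] at hi ⊢
        by_contra hc
        exact hi (if_neg fun h => hc ⟨h.2, h.1⟩)
      · simp only [hσ]
        split_ifs
        · exact hx i
        · simpa using hd.U_nonneg
      · set v : ℝ := ∑ i, (d.A' s i : ℝ) * (if d.blk i = d.blk j then x i else 0) with hv
        have hvY : |v| ≤ d.Y := by
          rw [hd.Y_eq]
          refine abs_sum_mul_le hd.A'_le (fun i => ?_) s
          split_ifs
          · exact hx i
          · simpa using hd.U_nonneg
        have h1 : |readReport d.Y d.η (h' s) - v| ≤ d.η := by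
          simp only [hh', hprobe]
          exact abs_readReport_sub_le hd.η_pos hvY
        have h2 : |∑ i, (d.A' s i : ℝ) * (σ i - if d.blk i = d.blk j then x i else 0)|
            ≤ n * n * (2 * d.κ) := by
          refine abs_sum_mul_le hd.A'_le (fun i => ?_) s
          simp only [hσ]
          by_cases hb : d.blk i = d.blk j
          · by_cases hiD : i ∈ D
            · simp only [hb, hiD, and_self, if_true, sub_self, abs_zero]
              linarith [hd.κ_nonneg]
            · simp only [hb, hiD, and_false, if_false, if_true, zero_sub, abs_neg]
              exact hnD i hiD
          · simp only [hb, false_and, if_false, sub_self, abs_zero]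
            linarith [hd.κ_nonneg]
        have h3 : ∑ i, (d.A' s i : ℝ) * (σ i - if d.blk i = d.blk j then x i else 0)
            = ∑ i, (d.A' s i : ℝ) * σ i - v := by
          rw [hv, ← Finset.sum_sub_distrib]
          exact Finset.sum_congr rfl fun i _ => mul_sub _ _ _
        rw [h3] at h2
        have h1' := abs_le.1 h1
        have h2' := abs_le.1 h2
        rw [hd.θ_eq, abs_le]
        constructor <;> linarith
    have hz'σ : |z' j - σ j| ≤ d.δ := (abs_decode_sub_le hd.robust' hexpl j).trans hd.le_δ
    rw [output, hhubf, hcf, if_neg hnot]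
    have hδ := hd.δ_pos
    have hκ := hd.κ_le
    split_ifs with hj
    · rw [List.length_nil, zero_add]
      have hσ0 : σ j ≠ 0 := fun h0 => by
        rw [h0, sub_zero] at hz'σ
        exact absurd hj (not_lt.2 hz'σ)
      have hjD : j ∈ D := by
        by_contra hc
        exact hσ0 (if_neg fun h => hc h.2)
      have hσx : σ j = x j := if_pos ⟨rfl, hjD⟩
      refine ⟨fun h0 => absurd h0 (hDx j hjD), ?_⟩
      have h1 := abs_le.1
        (abs_readAddress_sub_le (v := z' j) hδ (abs_decode_le hd.U_nonneg j))
      rw [hσx] at hz'σ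
      have h2 := abs_le.1 hz'σ
      rw [abs_le]
      constructor <;> linarith
    · simp only [List.length_nil, add_zero, readAddress, if_true, sub_zero, implies_true, true_and]
      by_cases hjD : j ∈ D
      · have hσx : σ j = x j := if_pos ⟨rfl, hjD⟩
        rw [hσx] at hz'σ
        have h1 := abs_le.1 (not_lt.1 hj)
        have h2 := abs_le.1 hz'σ
        rw [abs_le]
        constructor <;> linarith
      · have := hnD j hjD
        linarith

end DecoderData

/-! ### Norms -/

theorem lqNorm_le {n k : ℕ} {q : ℝ≥0∞} (hq : q ≠ 0) {e : Fin n → ℝ} {t : ℝ} (ht : 0 ≤ t)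
    (hk : (Finset.univ.filter fun j => e j ≠ 0).card ≤ k) (he : ∀ j, |e j| ≤ t) :
    lqNorm q e ≤ (k : ℝ) ^ (1 / q.toReal) * t := by
  rcases eq_or_ne q ∞ with rfl | hq'
  -- For `q = ∞` the exponent is `1 / 0 = 0`, which gives the convention `k ^ (1 / ∞) = 1`.
  · simp only [lqNorm, ENNReal.toReal_top, div_zero, Real.rpow_zero, one_mul]
    rw [PiLp.norm_eq_ciSup]
    exact Real.iSup_le (fun j => he j) ht
  · have hpos : 0 < q.toReal := ENNReal.toReal_pos hq hq'
    rw [lqNorm, PiLp.norm_eq_sum hpos]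
    have h1 : ∑ j, ‖(WithLp.toLp q e) j‖ ^ q.toReal ≤ k * t ^ q.toReal := by
      calc _ ≤ ∑ j, if e j ≠ 0 then t ^ q.toReal else 0 := by
            refine Finset.sum_le_sum fun j _ => ?_
            split_ifs with h
            · exact Real.rpow_le_rpow (norm_nonneg _) (he j) hpos.le
            · push Not at h
              simp [h, hpos.ne']
        _ = (Finset.univ.filter fun j => e j ≠ 0).card * t ^ q.toReal := by
            rw [← Finset.sum_filter]; simp
        _ ≤ k * t ^ q.toReal := by gcongr
    calc _ ≤ (k * t ^ q.toReal) ^ (1 / q.toReal) :=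
          Real.rpow_le_rpow (Finset.sum_nonneg fun j _ => by positivity) h1 (by positivity)
      _ = (k : ℝ) ^ (1 / q.toReal) * t := by
          rw [Real.mul_rpow (by positivity) (by positivity), ← Real.rpow_mul ht,
            mul_one_div_cancel hpos.ne', Real.rpow_one]

theorem lqNorm_pos {n : ℕ} {q : ℝ≥0∞} (hq : q ≠ 0) {x : Fin n → ℝ} {j : Fin n} (hj : x j ≠ 0) :
    0 < lqNorm q x := by
  have hj' : 0 < ‖(WithLp.toLp q x) j‖ := norm_pos_iff.2 hj
  rcases eq_or_ne q ∞ with rfl | hq'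
  · rw [lqNorm, PiLp.norm_eq_ciSup]
    exact hj'.trans_le (le_ciSup (f := fun j => ‖(WithLp.toLp ∞ x) j‖)
      (Set.finite_range _).bddAbove j)
  · have hpos : 0 < q.toReal := ENNReal.toReal_pos hq hq'
    rw [lqNorm, PiLp.norm_eq_sum hpos]
    refine Real.rpow_pos_of_pos ?_ _
    exact Finset.sum_pos' (fun i _ => by positivity)
      ⟨j, Finset.mem_univ _, Real.rpow_pos_of_pos hj' _⟩

/-! ### Events -/

/-- The support of a vector. -/
def supp {n : ℕ} (x : Fin n → ℝ) : Finset (Fin n) := Finset.univ.filter fun j => x j ≠ 0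

theorem mem_supp {n : ℕ} {x : Fin n → ℝ} {j : Fin n} : j ∈ supp x ↔ x j ≠ 0 := by simp [supp]

theorem IsSparseVector.card_supp {n k : ℕ} {U : ℝ} {x : Fin n → ℝ} (hx : IsSparseVector k U x) :
    (supp x).card = k := by
  rw [← hx.1, ← Set.ncard_coe_finset]
  congr 1
  ext j; simp [supp]

theorem IsSparseSource.real_supp_eq {n k : ℕ} {U : ℝ} {P : Measure (Fin n → ℝ)}
    (hP : IsSparseSource k U P) {S : Finset (Fin n)} (hS : S.card = k) :
    P.real {x | supp x = S} = ((n.choose k : ℕ) : ℝ)⁻¹ := by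
  have : {x : Fin n → ℝ | supp x = S} = {x | ∀ i, x i ≠ 0 ↔ i ∈ S} := by
    ext x
    simp only [Set.mem_ofPred_eq, Finset.ext_iff, mem_supp]
  rw [Measure.real, this, hP.uniform_support S hS]
  simp

theorem IsSparseSource.real_supp_mem_le {n k : ℕ} {U : ℝ} {P : Measure (Fin n → ℝ)}
    (hP : IsSparseSource k U P) (F : Finset (Finset (Fin n))) (hF : ∀ S ∈ F, S.card = k) :
    P.real {x | supp x ∈ F} ≤ F.card * ((n.choose k : ℕ) : ℝ)⁻¹ := by
  have := hP.isProbabilityMeasure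
  have hset : {x : Fin n → ℝ | supp x ∈ F} = ⋃ S ∈ F, {x | supp x = S} := by
    ext x; simp
  rw [hset]
  calc _ ≤ ∑ S ∈ F, P.real {x | supp x = S} := measureReal_biUnion_finset_le F _
    _ = ∑ S ∈ F, ((n.choose k : ℕ) : ℝ)⁻¹ := Finset.sum_congr rfl fun S hS => hP.real_supp_eq (hF S hS)
    _ = _ := by simp

/-- There is a linear form that vanishes on the vectors supported in `S` and, with probability
close to `1`, on no other vector. -/
theorem exists_test_form {n : ℕ} (P : Measure (Fin n → ℝ)) [IsProbabilityMeasure P]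
    (S : Finset (Fin n)) {ε : ℝ} (hε : 0 < ε) :
    ∃ c : Fin n → ℝ, (∀ j ∈ S, c j = 0) ∧
      P.real {x | ∑ j, c j * x j = 0 ∧ ∃ j, j ∉ S ∧ x j ≠ 0} ≤ ε := by
  classical
  -- A moment curve outside `S`: for fixed `x` the form is a polynomial in `t` whose coefficients
  -- are the entries of `x` outside `S`. If one of them is non-zero, at most `n` values of `t` are
  -- roots.
  let c : ℝ → Fin n → ℝ := fun t j => if j ∈ S then 0 else t ^ (j : ℕ)
  let E : ℝ → Set (Fin n → ℝ) := fun t => {x | ∑ j, c t j * x j = 0 ∧ ∃ j, j ∉ S ∧ x j ≠ 0}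
  have hE : ∀ t, MeasurableSet (E t) := fun t => by
    have h1 : MeasurableSet {x : Fin n → ℝ | ∑ j, c t j * x j = 0} :=
      measurableSet_eq_fun (by fun_prop) measurable_const
    have h2 : MeasurableSet {x : Fin n → ℝ | ∃ j, j ∉ S ∧ x j ≠ 0} := by
      have : {x : Fin n → ℝ | ∃ j, j ∉ S ∧ x j ≠ 0} = ⋃ j ∈ (S : Set (Fin n))ᶜ, {x | x j ≠ 0} := by
        ext x; simp
      rw [this]
      refine MeasurableSet.biUnion (Set.to_countable _) fun j _ => ?_
      have h3 : MeasurableSet ((fun x : Fin n → ℝ => x j) ⁻¹' {0}ᶜ) :=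
        measurable_pi_apply j (measurableSet_singleton (0 : ℝ)).compl
      exact h3
    exact h1.inter h2
  have hcount : ∀ (Z : Finset ℝ) (x : Fin n → ℝ), (Z.filter fun t => x ∈ E t).card ≤ n := by
    intro Z x
    rcases (Z.filter fun t => x ∈ E t).eq_empty_or_nonempty with he | ⟨t, ht⟩
    · simp [he]
    obtain ⟨j₀, hj₀, hx₀⟩ := (Finset.mem_filter.1 ht).2.2
    let p : Polynomial ℝ := ∑ j : Fin n, Polynomial.monomial (j : ℕ) (if j ∈ S then 0 else x j)
    have hcoeff : p.coeff j₀ = x j₀ := by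
      simp only [p, Polynomial.finsetSum_coeff, Polynomial.coeff_monomial]
      rw [Finset.sum_eq_single j₀]
      · simp [hj₀]
      · intro j _ hj
        rw [if_neg fun h => hj (Fin.ext h)]
      · simp
    have hp : p ≠ 0 := fun h => hx₀ (by rw [← hcoeff, h, Polynomial.coeff_zero])
    have hdeg : p.natDegree ≤ n := by
      refine Polynomial.natDegree_sum_le_of_forall_le _ _ fun j _ => ?_
      exact (Polynomial.natDegree_monomial_le _).trans j.2.le
    refine (Polynomial.card_le_degree_of_subset_roots (p := p) fun t ht => ?_).trans hdeg
    have ht' := (Finset.mem_filter.1 (show t ∈ Z.filter fun t => x ∈ E t from ht)).2.1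
    rw [Polynomial.mem_roots hp, Polynomial.IsRoot.def, ← ht']
    simp only [p, Polynomial.eval_finsetSum, Polynomial.eval_monomial, c]
    refine Finset.sum_congr rfl fun j _ => ?_
    split_ifs <;> ring
  -- Averaging over `N > n / ε` values of `t`: the probabilities of the bad events sum to at most
  -- `n`, so one of them is at most `ε`.
  obtain ⟨N, hN⟩ := exists_nat_gt (n / ε)
  rw [div_lt_iff₀ hε] at hN
  by_contra! hcon
  let Z : Finset ℝ := (Finset.range N).map Nat.castEmbedding
  have hZ : Z.card = N := by simp [Z]
  have hlow : (N : ℝ) * ε ≤ ∑ t ∈ Z, P.real (E t) := by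
    calc (N : ℝ) * ε = ∑ _t ∈ Z, ε := by simp [hZ]
      _ ≤ _ := Finset.sum_le_sum fun t _ =>
        (hcon (c t) fun j hj => by simp [c, hj]).le
  have hup : ∑ t ∈ Z, P.real (E t) ≤ n := by
    calc ∑ t ∈ Z, P.real (E t) = ∑ t ∈ Z, ∫ x, (E t).indicator (fun _ => (1 : ℝ)) x ∂P := by
          refine Finset.sum_congr rfl fun t _ => ?_
          rw [integral_indicator_const _ (hE t)]
          simp
      _ = ∫ x, ∑ t ∈ Z, (E t).indicator (fun _ => (1 : ℝ)) x ∂P := by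
          rw [integral_finsetSum]
          exact fun t _ => (integrable_const _).indicator (hE t)
      _ ≤ ∫ _x, (n : ℝ) ∂P := by
          refine integral_mono (integrable_finsetSum _ fun t _ =>
            (integrable_const _).indicator (hE t)) (integrable_const _) fun x => ?_
          have h : ∑ t ∈ Z, (E t).indicator (fun _ => (1 : ℝ)) x
              = ((Z.filter fun t => x ∈ E t).card : ℝ) := by
            rw [Finset.card_filter]
            push_cast
            exact Finset.sum_congr rfl fun t _ => by rw [Set.indicator_apply]
          exact h.trans_le (Nat.cast_le.2 (hcount Z x))
      _ = n := by simp
  linarith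

/-! ### The error probability of the two-level decoder -/

namespace DecoderData

variable {g a b r m n : ℕ} (d : DecoderData g a b n)

/-- The encoding matrix of the two-level decoder with the test form `c` at the hub. -/
def encoding (e : Fin m ≃ Role g a b r) (c : Fin n → ℝ) : Matrix (Fin m) (Fin n) ℂ := fun i j =>
  match e i with
  | .hub => ((c j : ℝ) : ℂ)
  | .centre _ => 0
  | .sensor s => ((d.A s j : ℝ) : ℂ)
  | .probe i s => if d.blk j = i then ((d.A' s j : ℝ) : ℂ) else 0
  | .idle _ => 0

variable (e : Fin m ≃ Role g a b r) (c : Fin n → ℝ) (x : Fin n → ℝ)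

theorem measurement_hub :
    measurement (d.encoding e c) x (e.symm .hub) = ((∑ j, c j * x j : ℝ) : ℂ) := by
  simp [measurement, Matrix.mulVec, dotProduct, encoding]

theorem measurement_sensor (s : Fin a) :
    measurement (d.encoding e c) x (e.symm (.sensor s))
      = ((∑ j, (d.A s j : ℝ) * x j : ℝ) : ℂ) := by
  simp [measurement, Matrix.mulVec, dotProduct, encoding]

theorem measurement_probe (i : Fin g) (s : Fin b) :
    measurement (d.encoding e c) x (e.symm (.probe i s))
      = ((∑ j, (d.A' s j : ℝ) * (if d.blk j = i then x j else 0) : ℝ) : ℂ) := by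
  simp only [measurement, Matrix.mulVec, dotProduct, encoding, Equiv.apply_symm_apply]
  push_cast
  refine Finset.sum_congr rfl fun j _ => ?_
  split_ifs <;> simp

variable {Λ : Submodule ℤ Plane} (pos : Role g a b r ⊕ Fin n → Plane)
  (hinj : Function.Injective pos) (hpos : ∀ u, pos u ∈ Λ)

theorem recover_circuit (pad : ℕ) (y : Fin m → ℂ) :
    ((d.protocol pad).circuit e pos hinj hpos).recover y = d.output fun i => y (e.symm i) := by
  funext j
  rw [Protocol.recover_circuit]
  rfl

/-- This permits choosing the padding after the error probability is known. -/
theorem errorProb_pad (pad : ℕ) (A : Matrix (Fin m) (Fin n) ℂ) (q : ℝ≥0∞) (Q : ℕ)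
    (P : Measure (Fin n → ℝ)) :
    ((d.protocol pad).circuit e pos hinj hpos).errorProb A q Q P
      = ((d.protocol 0).circuit e pos hinj hpos).errorProb A q Q P := by
  simp only [DecodingCircuit.errorProb, recover_circuit]

variable {d} {k Q : ℕ} {U c₀ : ℝ} {q : ℝ≥0∞} {P : Measure (Fin n → ℝ)} {S : Finset (Fin n)}

/-- The support equals `S` with probability `1 / n.choose k`. Then the hub stores `0`, the recovery
vector is `0`, and the relative error is `1 > 2 ^ (-Q)`. -/
theorem errorProb_pos (hP : IsSparseSource k U P) (hq : q ≠ 0) (hQ : 0 < Q) (hk : 0 < k)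
    (hkn : k ≤ n) (hS : S.card = k) (hc : ∀ j ∈ S, c j = 0) (pad : ℕ) :
    0 < ((d.protocol pad).circuit e pos hinj hpos).errorProb (d.encoding e c) q Q P := by
  have := hP.isProbabilityMeasure
  have h1 : 0 < P.real {x | supp x = S} := by
    rw [hP.real_supp_eq hS]
    have := Nat.choose_pos hkn
    positivity
  refine h1.trans_le (measureReal_mono fun x hx => ?_)
  obtain ⟨j, hj⟩ := Finset.card_pos.1 (hS ▸ hk)
  have hxj : x j ≠ 0 := by rwa [← mem_supp, hx]
  have hz : ∑ j, c j * x j = 0 := by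
    refine Finset.sum_eq_zero fun i _ => ?_
    by_cases hi : i ∈ S
    · rw [hc i hi, zero_mul]
    · have : x i = 0 := by
        by_contra h
        exact hi (hx ▸ mem_supp.2 h)
      rw [this, mul_zero]
  have hrec : ((d.protocol pad).circuit e pos hinj hpos).recover
      (measurement (d.encoding e c) x) = 0 := by
    rw [recover_circuit]
    funext j
    exact output_of_hub_eq_zero d _ (by rw [measurement_hub, hz]; simp) j
  rw [Set.mem_ofPred_eq, hrec, relativeError, sub_zero, div_self (lqNorm_pos hq hxj).ne']
  exact inv_lt_one_of_one_lt₀ (one_lt_pow₀ one_lt_two hQ.ne')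

/-- Errors need a small norm (`E₁`), a vanishing test form (`E₂`, or `E₃` when the support is `S`)
or too much overload (`E₄`). Otherwise the error has at most `k` non-zero entries of size at most `3
δ`, which is within the precision relative to `c₀ k ^ (1 / q) U`. -/
theorem errorProb_le (hd : d.Valid) (hdk : d.k = k) (hdU : d.U = U) (hU : 0 < U) (hc₀ : 0 < c₀)
    (hP : IsSparseSource k U P) (hq : q ≠ 0) (hk : 0 < k)
    (hS : S.card = k) {ε : ℝ} (hδ : 3 * d.δ ≤ ((2 : ℝ) ^ Q)⁻¹ * (c₀ * U))
    (hc : P.real {x | ∑ j, c j * x j = 0 ∧ ∃ j, j ∉ S ∧ x j ≠ 0} ≤ ε)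
    (hchoose : ((n.choose k : ℕ) : ℝ)⁻¹ ≤ ε)
    (hover : (((Finset.powersetCard k (Finset.univ : Finset (Fin n))).filter
      fun S => g ≤ (overload d.blk d.cap S).card).card : ℝ) * ((n.choose k : ℕ) : ℝ)⁻¹ ≤ ε)
    (pad : ℕ) :
    ((d.protocol pad).circuit e pos hinj hpos).errorProb (d.encoding e c) q Q P
      ≤ P.real {x | lqNorm q x < c₀ * (k : ℝ) ^ (1 / q.toReal) * U} + 3 * ε := by
  have := hP.isProbabilityMeasure
  set E₁ := {x | lqNorm q x < c₀ * (k : ℝ) ^ (1 / q.toReal) * U}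
  set E₂ := {x : Fin n → ℝ | ∑ j, c j * x j = 0 ∧ ∃ j, j ∉ S ∧ x j ≠ 0}
  set E₃ := {x : Fin n → ℝ | supp x = S}
  set F := (Finset.powersetCard k (Finset.univ : Finset (Fin n))).filter
      fun S => g ≤ (overload d.blk d.cap S).card with hF
  set E₄ := {x : Fin n → ℝ | supp x ∈ F}
  set E₅ := {x | ¬ IsSparseVector k U x}
  have h5 : P.real E₅ = 0 := by
    rw [Measure.real, show P E₅ = 0 from hP.ae_sparse]; rfl
  have h4 : P.real E₄ ≤ ε := (hP.real_supp_mem_le F fun S hS =>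
    (Finset.mem_powersetCard.1 (Finset.mem_filter.1 hS).1).2).trans hover
  have h3 : P.real E₃ ≤ ε := (hP.real_supp_eq hS).trans_le hchoose
  have hsub : {x | ((2 : ℝ) ^ Q)⁻¹ < relativeError q x
      (((d.protocol pad).circuit e pos hinj hpos).recover (measurement (d.encoding e c) x))}
      ⊆ E₁ ∪ (E₂ ∪ (E₃ ∪ (E₄ ∪ E₅))) := by
    intro x hx
    by_contra hn
    simp only [Set.mem_union, not_or] at hn
    obtain ⟨n1, n2, n3, n4, n5⟩ := hn
    have hxs : IsSparseVector k U x := not_not.1 n5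
    have hcard : (supp x).card = k := hxs.card_supp
    have hhub : ∑ j, c j * x j ≠ 0 := by
      intro h0
      refine n3 (Finset.eq_of_subset_of_card_le (fun j hj => ?_) (by rw [hcard, hS]))
      by_contra hjS
      exact n2 ⟨h0, j, hjS, mem_supp.1 hj⟩
    have hov : (overload d.blk d.cap (supp x)).card < g := by
      by_contra! h
      exact n4 (show supp x ∈ F from Finset.mem_filter.2 ⟨Finset.mem_powersetCard.2 ⟨Finset.subset_univ _, hcard⟩, h⟩)
    have hspec := output_spec hd (x := x) (r := r)
      (y := fun i => measurement (d.encoding e c) x (e.symm i))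
      (by rw [hdk]; exact hcard.le) (by rw [hdU]; exact hxs.2)
      (by rw [measurement_hub]; exact_mod_cast hhub)
      (fun s => measurement_sensor d e c x s) (fun i s => measurement_probe d e c x i s) hov
    rw [Set.mem_ofPred_eq, recover_circuit, relativeError] at hx
    set o := d.output fun i => measurement (d.encoding e c) x (e.symm i) with ho
    have hkpos : 0 < (k : ℝ) ^ (1 / q.toReal) :=
      Real.rpow_pos_of_pos (Nat.cast_pos.2 hk) _
    have herr : lqNorm q (x - o) ≤ (k : ℝ) ^ (1 / q.toReal) * (3 * d.δ) := by
      refine lqNorm_le hq (by linarith [hd.δ_pos]) ?_ fun j => (hspec j).2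
      rw [← hcard]
      refine Finset.card_le_card fun j hj => ?_
      rw [Finset.mem_filter] at hj
      rw [mem_supp]
      intro h0
      exact hj.2 (by rw [Pi.sub_apply, h0, (hspec j).1 h0, sub_zero])
    have hlow : c₀ * (k : ℝ) ^ (1 / q.toReal) * U ≤ lqNorm q x := not_lt.1 n1
    have hlpos : 0 < lqNorm q x := lt_of_lt_of_le (by positivity) hlow
    rw [lt_div_iff₀ hlpos] at hx
    have h2Q : 0 < ((2 : ℝ) ^ Q)⁻¹ := by positivity
    have h6 : (k : ℝ) ^ (1 / q.toReal) * (3 * d.δ)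
        ≤ ((2 : ℝ) ^ Q)⁻¹ * (c₀ * (k : ℝ) ^ (1 / q.toReal) * U) := by
      calc _ ≤ (k : ℝ) ^ (1 / q.toReal) * (((2 : ℝ) ^ Q)⁻¹ * (c₀ * U)) := by gcongr
        _ = _ := by ring
    have h7 := mul_le_mul_of_nonneg_left hlow h2Q.le
    linarith
  calc _ ≤ P.real (E₁ ∪ (E₂ ∪ (E₃ ∪ (E₄ ∪ E₅)))) := measureReal_mono hsub
    _ ≤ P.real E₁ + (P.real E₂ + (P.real E₃ + (P.real E₄ + P.real E₅))) := by
        refine (measureReal_union_le _ _).trans (add_le_add le_rfl ?_)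
        refine (measureReal_union_le _ _).trans (add_le_add le_rfl ?_)
        refine (measureReal_union_le _ _).trans (add_le_add le_rfl ?_)
        exact measureReal_union_le _ _
    _ ≤ _ := by rw [h5]; linarith

end DecoderData

/-! ### Sizes -/

theorem two_pow_le_choose {n k : ℕ} (h : 3 * k ≤ n) : 2 ^ k ≤ n.choose k := by
  have h1 := Nat.pow_le_choose (α := ℝ) k n
  have h2 : ((k.factorial : ℕ) : ℝ) ≤ (k : ℝ) ^ k := by exact_mod_cast Nat.factorial_le_pow k
  have h3 : (2 * (k : ℝ)) ^ k ≤ ((n + 1 - k : ℕ) : ℝ) ^ k := by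
    refine pow_le_pow_left₀ (by positivity) ?_ k
    have : 2 * k ≤ n + 1 - k := by omega
    exact_mod_cast this
  rw [div_le_iff₀ (by positivity)] at h1
  have h4 : (2 : ℝ) ^ k * k.factorial ≤ n.choose k * k.factorial := by
    refine le_trans ?_ h1
    refine le_trans ?_ h3
    rw [mul_pow]
    gcongr
  have h5 := le_of_mul_le_mul_right h4 (by positivity)
  exact_mod_cast h5

theorem card_filter_mod_le {n g : ℕ} (i : ℕ) :
    (Finset.univ.filter fun j : Fin n => (j : ℕ) % g = i).card ≤ n / g + 1 := by
  rw [← Finset.card_range (n / g + 1)]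
  refine Finset.card_le_card_of_injOn (fun j => (j : ℕ) / g) (fun j _ => ?_) ?_
  · rw [Finset.coe_range, Set.mem_Iio]
    exact Nat.lt_succ_of_le (Nat.div_le_div_right j.2.le)
  · intro j hj j' hj' h
    simp only [Finset.coe_filter, Finset.mem_univ, true_and, Set.mem_ofPred_eq] at hj hj'
    simp only at h
    apply Fin.ext
    rw [← Nat.div_add_mod j g, ← Nat.div_add_mod j' g, h, hj, hj']

/-- The sizes for which the two-level decoder with `k / l` blocks is efficient. -/
structure Regime (n k l : ℕ) : Prop where
  five_le : 5 ≤ l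
  lt_two_pow : n < 2 ^ (l + 1)
  pow_six_le : l ^ 6 ≤ k
  pow_four_mul_le : l ^ 4 * k ≤ n

namespace Regime

variable {n k l : ℕ}

theorem mul_le (h : Regime n k l) : 625 * k ≤ n := by
  have : 5 ^ 4 ≤ l ^ 4 := Nat.pow_le_pow_left h.five_le 4
  exact (Nat.mul_le_mul_right k this).trans h.pow_four_mul_le

theorem mul_self_le (h : Regime n k l) : 625 * (l * l) ≤ k := by
  have : 5 ^ 4 ≤ l ^ 4 := Nat.pow_le_pow_left h.five_le 4
  calc 625 * (l * l) ≤ l ^ 4 * (l * l) := Nat.mul_le_mul_right _ this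
    _ = l ^ 6 := by ring
    _ ≤ k := h.pow_six_le

theorem k_pos (h : Regime n k l) : 0 < k := by
  have := h.mul_self_le
  have := h.five_le
  nlinarith

theorem add_le_div (h : Regime n k l) : l + 4 ≤ k / l := by
  have := h.mul_self_le
  have := h.five_le
  rw [Nat.le_div_iff_mul_le (by omega)]
  nlinarith

theorem le_two_mul_div (h : Regime n k l) : k ≤ 2 * (k / l * l) := by
  have h1 := h.add_le_div
  have h2 := h.five_le
  have h3 := Nat.lt_div_mul_add (a := k) (show 0 < l by omega)
  nlinarith

/-- `log n` is at most of order `l`, and `log (1 / Pe) ≥ (g - 2) log 2` is at least of order `g`,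
hence of order `k / l`. -/
theorem tightOrder_ge (h : Regime n k l) {Pe : ℝ} (hPe : 0 < Pe) (hPe' : Pe ≤ 4 * ((2 : ℝ) ^ (k / l))⁻¹) :
    (k : ℝ) * √n / l ≤ 3 * tightOrder n k Pe := by
  set g := k / l with hg
  have hl : (0 : ℝ) < l := by have := h.five_le; positivity
  have hl1 : (1 : ℝ) ≤ l := by have := h.five_le; exact_mod_cast (by omega : 1 ≤ l)
  have hk : (0 : ℝ) < k := Nat.cast_pos.2 h.k_pos
  have hg4 : (4 : ℝ) ≤ g := by
    have := h.add_le_div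
    exact_mod_cast (by omega : 4 ≤ g)
  have hn1 : 1 < n := by have := h.mul_le; have := h.k_pos; omega
  have hn : (0 : ℝ) < n := by positivity
  have hlogn : 0 < Real.log n := Real.log_pos (by exact_mod_cast hn1)
  have hlog2 : 0 < Real.log 2 := Real.log_pos one_lt_two
  have h1 : Real.log n ≤ 2 * l * Real.log 2 := by
    calc Real.log n ≤ Real.log ((2 : ℝ) ^ (l + 1)) :=
          Real.log_le_log hn (by exact_mod_cast h.lt_two_pow.le)
      _ = (l + 1) * Real.log 2 := by rw [Real.log_pow]; push_cast; rfl
      _ ≤ 2 * l * Real.log 2 := by gcongr; linarith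
  have h2 : g / 2 * Real.log 2 ≤ Real.log (1 / Pe) := by
    have h3 : (2 : ℝ) ^ g / 4 ≤ 1 / Pe := by
      rw [le_div_iff₀ hPe]
      calc (2 : ℝ) ^ g / 4 * Pe ≤ (2 : ℝ) ^ g / 4 * (4 * ((2 : ℝ) ^ g)⁻¹) := by gcongr
        _ = 1 := by field_simp
    calc g / 2 * Real.log 2 ≤ (g - 2) * Real.log 2 := by gcongr; linarith
      _ = Real.log ((2 : ℝ) ^ g / 4) := by
          rw [Real.log_div (by positivity) (by norm_num), Real.log_pow,
            show (4 : ℝ) = 2 ^ 2 by norm_num, Real.log_pow]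
          push_cast; ring
      _ ≤ _ := Real.log_le_log (by positivity) h3
  have hgl : (k : ℝ) ≤ 2 * (g * l) := by exact_mod_cast h.le_two_mul_div
  have h4 : (k * √n / l / 3) ^ 2 ≤ (n : ℝ) * k / Real.log n * Real.log (1 / Pe) := by
    have h5 : (n : ℝ) * k / (2 * l * Real.log 2) * (g / 2 * Real.log 2)
        ≤ (n : ℝ) * k / Real.log n * Real.log (1 / Pe) := by gcongr
    refine le_trans ?_ h5
    have h6 : (k * √n / l / 3) ^ 2 = k * n * (k / l) / (9 * l) := by
      rw [div_pow, div_pow, mul_pow, Real.sq_sqrt hn.le]; field_simp; ring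
    have h7 : (n : ℝ) * k / (2 * l * Real.log 2) * (g / 2 * Real.log 2)
        = k * n * (9 * g / 4) / (9 * l) := by field_simp; ring
    rw [h6, h7]
    have h8 : (k : ℝ) / l ≤ 9 * g / 4 := by
      rw [div_le_iff₀ hl]
      nlinarith [mul_pos (show (0:ℝ) < g by linarith) hl]
    gcongr
  have h9 : k * √n / l / 3 ≤ tightOrder n k Pe := by
    rw [tightOrder, ← Real.sqrt_mul (by positivity)]
    exact Real.le_sqrt_of_sq_le h4
  linarith

set_option maxHeartbeats 400000 in
/-- The total length of the links of the two-level decoder, weighted with the traffic. -/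
theorem cost_le (h : Regime n k l) {B : ℝ} (hB : 1 ≤ B) (V : ℕ) {G R S a b β W₁ W₂ : ℕ}
    (ha : a = 8 * k + 1) (hb : b = 8 * (48 * l) + 1) (hβ : β = 9 * (l + 1))
    (hG : G = (k / l).sqrt + 1) (hR : R = a.sqrt + 1)
    (hS : S = (b + 1 + n / (k / l)).sqrt + 1) (hW₁ : W₁ = k / l * V) (hW₂ : W₂ = 48 * l * V) :
    ((k / l : ℕ) : ℝ) * (2 * B * (G * S + R)) + W₁ * (2 * B * (G * S + R)) + a * β * (2 * B * R)
        + (k / l : ℕ) * b * β * (2 * B * S) + (k / l : ℕ) * W₂ * (2 * B * S)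
      ≤ B * (30000 + 300 * V) * (k * √n / l) ∧ 2 * B * R ≤ 8 * B * (k * √n / l) := by
  have hadd := h.add_le_div
  have hgl' := Nat.div_mul_le_self k l
  set g := k / l with hg
  have hl5 := h.five_le
  have hl : (0 : ℝ) < l := by positivity
  have hl1 : (5 : ℝ) ≤ l := by exact_mod_cast hl5
  have hk0 := h.k_pos
  have hk : (1 : ℝ) ≤ k := by exact_mod_cast hk0
  have hg1 : (1 : ℝ) ≤ g := by exact_mod_cast (by omega : 1 ≤ g)
  have hgl : (g : ℝ) * l ≤ k := by exact_mod_cast hgl'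
  have hkn : (625 : ℝ) * k ≤ n := by exact_mod_cast h.mul_le
  have h6 : (l : ℝ) ^ 6 ≤ k := by exact_mod_cast h.pow_six_le
  have h4 : (l : ℝ) ^ 4 * k ≤ n := by exact_mod_cast h.pow_four_mul_le
  have hV : (0 : ℝ) ≤ V := Nat.cast_nonneg _
  set sk := √(k : ℝ) with hsk
  set sn := √(n : ℝ) with hsn
  set sg := √(g : ℝ) with hsg
  have hsk1 : 1 ≤ sk := Real.one_le_sqrt.2 hk
  have hsg1 : 1 ≤ sg := Real.one_le_sqrt.2 hg1
  have hsk2 : sk * sk = k := Real.mul_self_sqrt (by positivity)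
  have hsn2 : sn * sn = n := Real.mul_self_sqrt (by positivity)
  have hsg2 : sg * sg = g := Real.mul_self_sqrt (by positivity)
  have hsn0 : 0 ≤ sn := Real.sqrt_nonneg _
  have hl3 : (l : ℝ) ^ 3 ≤ sk := Real.le_sqrt_of_sq_le (by linarith [show ((l : ℝ) ^ 3) ^ 2 = l ^ 6 by ring])
  have hl2 : (l : ℝ) ^ 2 * sk ≤ sn := by
    refine Real.le_sqrt_of_sq_le ?_
    calc ((l : ℝ) ^ 2 * sk) ^ 2 = l ^ 4 * (sk * sk) := by ring
      _ ≤ (n : ℝ) := by rw [hsk2]; exact h4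
  have hgk : (g : ℝ) ≤ k :=
    (le_mul_of_one_le_right (by positivity) (by linarith : (1 : ℝ) ≤ l)).trans hgl
  have hsgk : sg ≤ sk := Real.sqrt_le_sqrt hgk
  have hskn : sk ≤ sn := Real.sqrt_le_sqrt (by linarith)
  have hRle : (R : ℝ) ≤ 4 * sk := by
    have h1 : ((a.sqrt : ℕ) : ℝ) ≤ √(a : ℝ) := Real.nat_sqrt_le_real_sqrt
    have h2 : √(a : ℝ) ≤ 3 * sk := by
      rw [Real.sqrt_le_left (by positivity), ha]
      push_cast
      nlinarith
    rw [hR]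
    push_cast
    linarith
  have hGle : (G : ℝ) ≤ 2 * sg := by
    have h1 : ((g.sqrt : ℕ) : ℝ) ≤ √(g : ℝ) := Real.nat_sqrt_le_real_sqrt
    rw [hG]
    push_cast
    linarith
  have hgb : (g : ℝ) * b ≤ 385 * k := by
    rw [hb]
    push_cast
    calc (g : ℝ) * (8 * (48 * l) + 1) = 384 * (g * l) + g := by ring
      _ ≤ 385 * k := by linarith
  have hSle : sg * S ≤ 2 * sn := by
    have h1 : ((b + 1 + n / g).sqrt : ℝ) ≤ √((b + 1 + n / g : ℕ) : ℝ) := Real.nat_sqrt_le_real_sqrt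
    set T := √((b + 1 + n / g : ℕ) : ℝ) with hT
    have hT2 : T * T = ((b + 1 + n / g : ℕ) : ℝ) := Real.mul_self_sqrt (by positivity)
    have hng : (g : ℝ) * ((n / g : ℕ) : ℝ) ≤ n := by
      exact_mod_cast Nat.mul_div_le n g
    have h2 : sg * T ≤ 3 / 2 * sn := by
      have h3 : (sg * T) ^ 2 ≤ (3 / 2 * sn) ^ 2 := by
        calc (sg * T) ^ 2 = (sg * sg) * (T * T) := by ring
          _ = g * b + g + g * ((n / g : ℕ) : ℝ) := by rw [hsg2, hT2]; push_cast; ring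
          _ ≤ 385 * k + k + n := by linarith
          _ ≤ 9 / 4 * n := by linarith
          _ = (3 / 2 * sn) ^ 2 := by rw [← hsn2]; ring
      exact (abs_le_of_sq_le_sq' h3 (by positivity)).2
    have h4 : 25 * sk ≤ sn := by
      refine Real.le_sqrt_of_sq_le ?_
      calc (25 * sk) ^ 2 = 625 * (sk * sk) := by ring
        _ ≤ (n : ℝ) := by rw [hsk2]; exact hkn
    have h5 : (S : ℝ) ≤ T + 1 := by rw [hS]; push_cast; linarith
    calc sg * S ≤ sg * (T + 1) := by gcongr
      _ = sg * T + sg := by ring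
      _ ≤ 2 * sn := by linarith
  have hgS : g * (S : ℝ) ≤ 2 * (sk * sn) := by
    calc g * (S : ℝ) = sg * (sg * S) := by rw [← hsg2]; ring
      _ ≤ sk * (2 * sn) := by gcongr
      _ = 2 * (sk * sn) := by ring
  have hGS : (G : ℝ) * S ≤ 4 * sn := by
    calc (G : ℝ) * S ≤ 2 * sg * S := by gcongr
      _ ≤ 4 * sn := by linarith
  -- All costs reduce to three comparisons with `X`: `g √n` by `g l ≤ k` (long links), `l ^ 2 √k √n`
  -- by `l ^ 3 ≤ √k` (inside the cells), and `k l √k` by `l ^ 2 √k ≤ √n` (cluster of the hub).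
  set X := k * sn / l with hX
  have hX0 : 0 ≤ X := by positivity
  have hgX : g * sn ≤ X := by
    rw [hX, le_div_iff₀ hl]
    calc g * sn * l = g * l * sn := by ring
      _ ≤ k * sn := by gcongr
  have hX2 : (l : ℝ) ^ 2 * (sk * sn) ≤ X := by
    rw [hX, le_div_iff₀ hl]
    calc (l : ℝ) ^ 2 * (sk * sn) * l = l ^ 3 * (sk * sn) := by ring
      _ ≤ sk * (sk * sn) := by gcongr
      _ = k * sn := by rw [← hsk2]; ring
  have hX3 : k * l * sk ≤ X := by
    rw [hX, le_div_iff₀ hl]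
    calc k * l * sk * l = k * (l ^ 2 * sk) := by ring
      _ ≤ k * sn := by gcongr
  have hBpos : 0 < B := by linarith
  have hD : 2 * B * (G * S + R) ≤ 16 * B * sn := by
    calc 2 * B * (G * S + R) ≤ 2 * B * (4 * sn + 4 * sn) := by gcongr; linarith
      _ = 16 * B * sn := by ring
  have e1 : (g : ℝ) * (2 * B * (G * S + R)) ≤ 16 * B * X := by
    calc (g : ℝ) * (2 * B * (G * S + R)) ≤ g * (16 * B * sn) := by gcongr
      _ = 16 * B * (g * sn) := by ring
      _ ≤ 16 * B * X := by gcongr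
  have e2 : (W₁ : ℝ) * (2 * B * (G * S + R)) ≤ 16 * B * V * X := by
    rw [hW₁]
    push_cast
    calc (g : ℝ) * V * (2 * B * (G * S + R)) = V * (g * (2 * B * (G * S + R))) := by ring
      _ ≤ V * (16 * B * X) := by gcongr
      _ = _ := by ring
  have hβle : (β : ℝ) ≤ 18 * l := by rw [hβ]; push_cast; linarith
  have hale : (a : ℝ) ≤ 9 * k := by rw [ha]; push_cast; linarith
  have hble : (b : ℝ) ≤ 385 * l := by rw [hb]; push_cast; linarith
  have e3 : (a : ℝ) * β * (2 * B * R) ≤ 1296 * B * X := by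
    calc (a : ℝ) * β * (2 * B * R) ≤ (9 * k) * (18 * l) * (2 * B * (4 * sk)) := by gcongr
      _ = 1296 * B * (k * l * sk) := by ring
      _ ≤ _ := by gcongr
  have e4 : (g : ℝ) * b * β * (2 * B * S) ≤ 27720 * B * X := by
    calc (g : ℝ) * b * β * (2 * B * S) = b * β * (2 * B) * (g * S) := by ring
      _ ≤ (385 * l) * (18 * l) * (2 * B) * (2 * (sk * sn)) := by gcongr
      _ = 27720 * B * (l ^ 2 * (sk * sn)) := by ring
      _ ≤ _ := by gcongr
  have e5 : (g : ℝ) * W₂ * (2 * B * S) ≤ 192 * B * V * X := by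
    rw [hW₂]
    push_cast
    calc (g : ℝ) * (48 * l * V) * (2 * B * S) = 96 * B * V * l * (g * S) := by ring
      _ ≤ 96 * B * V * l * (2 * (sk * sn)) := by gcongr
      _ = 192 * B * V * (l * (sk * sn)) := by ring
      _ ≤ 192 * B * V * (l ^ 2 * (sk * sn)) := by
          have : (l : ℝ) ≤ l ^ 2 := by nlinarith
          gcongr
      _ ≤ _ := by gcongr
  constructor
  · have : 0 ≤ B * V * X := by positivity
    have : 0 ≤ B * X := by positivity
    linarith
  · have : sk ≤ X := by
      refine le_trans ?_ hX3
      have : (1 : ℝ) ≤ k * l := one_le_mul_of_one_le_of_one_le hk (by linarith)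
      exact le_mul_of_one_le_left (by positivity) this
    calc 2 * B * R ≤ 2 * B * (4 * X) := by gcongr; linarith
      _ = _ := by ring

end Regime

/-! ### The two-level decoder at a fixed length -/

theorem Regime.exists_decoderData {n k l : ℕ} (h : Regime n k l) {U δ : ℝ} (hU : 0 < U)
    (hδ : 0 < δ) (hn : 420 * U / δ ≤ n) {g a b : ℕ} (hg : g = k / l) (ha : a = 8 * k + 1)
    (hb : b = 8 * (48 * l) + 1) :
    ∃ d : DecoderData g a b n, d.Valid ∧ d.k = k ∧ d.U = U ∧
      d.δ = δ ∧ d.cap = 48 * l ∧ (∀ j, (d.blk j : ℕ) = (j : ℕ) % g) ∧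
      d.Y = n * n * U ∧ 2 * d.Y / d.η < 2 ^ (9 * (l + 1)) := by
  subst hg ha hb
  have h1 := h.mul_le
  have h2 := h.mul_self_le
  have h3 := h.five_le
  have h4 := h.add_le_div
  have hl : l ≤ l * l := Nat.le_mul_self l
  have hn11 : 11 ≤ n := by omega
  obtain ⟨A, hA, hA'⟩ := exists_robust_matrix (m := 8 * k + 1) hn11 (show k ≤ n by omega)
    (Nat.lt_succ_self _)
  obtain ⟨A', hB, hB'⟩ := exists_robust_matrix (m := 8 * (48 * l) + 1) hn11
    (show 48 * l ≤ n by omega) (Nat.lt_succ_self _)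
  have hn0 : (0 : ℝ) < n := by positivity
  have hn1 : (1 : ℝ) ≤ n := by exact_mod_cast (by omega : 1 ≤ n)
  -- With `N = 5 n ^ 2` one has `κ = 10 n ^ 2 η` and `N * (2 θ) = (10 n ^ 2 + 200 n ^ 6) η ≤ 210 n ^
  -- 6 η = δ`. The number of quantization steps is `(420 U / δ) n ^ 8 ≤ n ^ 9`, hence reports of `9
  -- (l + 1)` bits.
  set η : ℝ := δ / (210 * (n : ℝ) ^ 6) with hη
  have hη0 : 0 < η := by positivity
  have hδη : δ = 210 * (n : ℝ) ^ 6 * η := by rw [hη]; field_simp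
  have hp4 : (1 : ℝ) ≤ (n : ℝ) ^ 4 := one_le_pow₀ hn1
  set N : ℝ := 5 * (n : ℝ) ^ 2 with hN
  refine ⟨⟨A, A', fun j => ⟨(j : ℕ) % (k / l), Nat.mod_lt _ (by omega)⟩, k, 48 * l, U, n * n * U,
    η, N * (2 * η), η + n * n * (2 * (N * (2 * η))), δ, N⟩, ⟨hA, hB, hA', hB', hU.le, hη0, hδ,
    rfl, rfl, rfl, ?_, ?_, ?_⟩, rfl, rfl, rfl, rfl, fun _ => rfl, rfl, ?_⟩
  · calc N * (2 * (η + n * n * (2 * (N * (2 * η)))))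
        = (10 * (n : ℝ) ^ 2 * 1 + 200 * (n : ℝ) ^ 6) * η := by rw [hN]; ring
      _ ≤ (10 * (n : ℝ) ^ 2 * (n : ℝ) ^ 4 + 200 * (n : ℝ) ^ 6) * η := by gcongr
      _ = δ := by rw [hδη]; ring
  · positivity
  · calc N * (2 * η) = 10 * (n : ℝ) ^ 2 * 1 * η := by rw [hN]; ring
      _ ≤ 210 * (n : ℝ) ^ 2 * (n : ℝ) ^ 4 * η := by gcongr; norm_num
      _ = δ := by rw [hδη]; ring
  · have h5 : (n : ℝ) < 2 ^ (l + 1) := by exact_mod_cast h.lt_two_pow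
    calc 2 * ((n : ℝ) * n * U) / η = 420 * U / δ * (n : ℝ) ^ 8 := by
          rw [hη]; field_simp; ring
      _ ≤ n * (n : ℝ) ^ 8 := by gcongr
      _ = (n : ℝ) ^ 9 := by ring
      _ < (2 ^ (l + 1)) ^ 9 := by gcongr
      _ = 2 ^ (9 * (l + 1)) := by rw [← pow_mul]; ring_nf

theorem Regime.card_overload_le {n k l : ℕ} (h : Regime n k l) {g : ℕ} (hg : g = k / l)
    (blk : Fin n → Fin g) (hblk : ∀ j, (blk j : ℕ) = (j : ℕ) % g) :
    (((Finset.powersetCard k (Finset.univ : Finset (Fin n))).filter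
      fun S => g ≤ (overload blk (48 * l) S).card).card : ℝ) * ((n.choose k : ℕ) : ℝ)⁻¹
      ≤ ((2 : ℝ) ^ g)⁻¹ := by
  subst hg
  have h1 := h.mul_le
  have h4 := h.add_le_div
  have h5 := h.le_two_mul_div
  have h6 := h.k_pos
  have hgk : k / l ≤ k := Nat.div_le_self _ _
  have hg : 0 < k / l := by omega
  have hF : (n / (k / l) + 1) * (k / l) ≤ 2 * n := by
    have := Nat.div_mul_le_self n (k / l)
    rw [add_mul, one_mul]
    omega
  -- The capacity `48 l` comes from `24 k ≤ cap * g`, because rounding leaves only `k ≤ 2 g l`.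
  have hcount := card_overload_mul_le (k := k) (cap := 48 * l) blk (by omega)
    (fun a => le_trans (le_of_eq (by simp only [Fin.ext_iff, hblk])) (card_filter_mod_le (a : ℕ)))
    hF (by rw [mul_assoc, mul_comm l]; omega) hg
  have hch : (0 : ℝ) < ((n.choose k : ℕ) : ℝ) := by
    exact_mod_cast Nat.choose_pos (show k ≤ n by omega)
  rw [← div_eq_mul_inv, div_le_iff₀ hch, inv_mul_eq_div, le_div_iff₀ (by positivity)]
  exact_mod_cast hcount

/-- The constant in the upper bound for the bit-meters of the two-level decoder, for links of
length at most `B` times the lattice distance and addresses of at most `V` bits. -/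
def costConstant (B : ℝ) (V : ℕ) : ℝ := 1 + 3 * (8 * B + B * (30000 + 300 * V))

theorem Regime.exists_circuit {Λ : Submodule ℤ Plane} {B : ℝ} (hB : 1 ≤ B)
    (hΛ : HasLayouts Λ B) {n k l m Q : ℕ} (h : Regime n k l) {U δ c₀ : ℝ} (hU : 0 < U)
    (hc₀ : 0 < c₀) {q : ℝ≥0∞} (hq : q ≠ 0) (hQ : 0 < Q) (hδ : 0 < δ)
    (hδ' : 3 * δ ≤ ((2 : ℝ) ^ Q)⁻¹ * (c₀ * U)) (hn : 420 * U / δ ≤ n) (hm : 400 * k ≤ m)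
    {P : Measure (Fin n → ℝ)} (hP : IsSparseSource k U P)
    (hsmall : P.real {x | lqNorm q x < c₀ * (k : ℝ) ^ (1 / q.toReal) * U}
      ≤ ((2 : ℝ) ^ (k / l))⁻¹) :
    ∃ (A : Matrix (Fin m) (Fin n) ℂ) (ckt : DecodingCircuit Λ m n),
      0 < ckt.errorProb A q Q P ∧ ckt.errorProb A q Q P ≤ 4 / √k ∧
      1 * tightOrder n k (ckt.errorProb A q Q P) ≤ ∫ x, ckt.bitMeters (measurement A x) ∂P ∧
      ∀ x : Fin n → ℝ, IsSparseVector k U x → ckt.bitMeters (measurement A x)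
        ≤ costConstant B (⌊2 * U / δ⌋₊ + 1) * tightOrder n k (ckt.errorProb A q Q P) := by
  have := hP.isProbabilityMeasure
  have h1 := h.mul_le
  have h3 := h.five_le
  have h4 := h.add_le_div
  have h6 := h.k_pos
  have hgl := Nat.div_mul_le_self k l
  have hgk : k / l ≤ k := Nat.div_le_self _ _
  have hcost := h.cost_le hB (⌊2 * U / δ⌋₊ + 1) rfl rfl rfl rfl rfl rfl rfl rfl
  have htight := fun Pe => h.tightOrder_ge (Pe := Pe)
  obtain ⟨g, hg⟩ : ∃ g, g = k / l := ⟨_, rfl⟩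
  obtain ⟨a, ha⟩ : ∃ a, a = 8 * k + 1 := ⟨_, rfl⟩
  obtain ⟨b, hb⟩ : ∃ b, b = 8 * (48 * l) + 1 := ⟨_, rfl⟩
  obtain ⟨d, hd, hdk, hdU, hdδ, hdcap, hblk, hdY, hβ⟩ := h.exists_decoderData hU hδ hn hg ha hb
  have hover := h.card_overload_le hg d.blk hblk
  rw [← hg] at h4 hgl hgk hsmall
  simp only [← hg, ← ha, ← hb] at hcost htight
  have hε : (0 : ℝ) < ((2 : ℝ) ^ g)⁻¹ := by positivity
  obtain ⟨S, -, hS⟩ := Finset.exists_subset_card_eq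
    (show k ≤ (Finset.univ : Finset (Fin n)).card by simp; omega)
  obtain ⟨c, hc, hcε⟩ := exists_test_form P S hε
  -- Sensors and probes take about `8 k + 384 g l ≤ 392 k` measurements; the remaining `8 k` cover
  -- the hub, the centres and the additive ones.
  have hroles : 1 + (g + (a + (g * b))) ≤ m := by
    have : g * b = 384 * (g * l) + g := by rw [hb]; ring
    omega
  obtain ⟨r, hr⟩ := Nat.exists_eq_add_of_le hroles
  have hcard : Fintype.card (Fin m) = Fintype.card (Role g a b r) := by
    rw [Fintype.card_fin, Role.card_eq, hr]; ring
  let e : Fin m ≃ Role g a b r := Fintype.equivOfCardEq hcard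
  obtain ⟨G, hG⟩ : ∃ G, G = g.sqrt + 1 := ⟨_, rfl⟩
  obtain ⟨R, hR⟩ : ∃ R, R = a.sqrt + 1 := ⟨_, rfl⟩
  obtain ⟨T, hT⟩ : ∃ T, T = (b + 1 + n / g).sqrt + 1 := ⟨_, rfl⟩
  rw [← hG, ← hR, ← hT] at hcost
  obtain ⟨pos, hinj, hpos, d1, d2, d2', d3, d3'⟩ := hΛ G R T g a b r n
    (by rw [hR]; exact Nat.lt_succ_sqrt a) (by rw [hT]; exact Nat.lt_succ_sqrt _)
    (by rw [hG]; exact (Nat.lt_succ_sqrt g).le) (by omega)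
  let s₀ : Fin a := ⟨0, by omega⟩
  let ckt : ℕ → DecodingCircuit Λ m n := fun pad => (d.protocol pad).circuit e pos hinj hpos
  let A := d.encoding e c
  let Pe := (ckt 0).errorProb A q Q P
  have hPe : ∀ pad, (ckt pad).errorProb A q Q P = Pe := fun pad =>
    d.errorProb_pad e pos hinj hpos pad A q Q P
  have hPe0 : 0 < Pe := DecoderData.errorProb_pos e c pos hinj hpos hP hq hQ h6 (by omega) hS hc 0
  have hchoose : ((n.choose k : ℕ) : ℝ)⁻¹ ≤ ((2 : ℝ) ^ g)⁻¹ := by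
    refine inv_anti₀ (by positivity) ?_
    calc (2 : ℝ) ^ g ≤ 2 ^ k := pow_le_pow_right₀ one_le_two hgk
      _ ≤ _ := by exact_mod_cast two_pow_le_choose (show 3 * k ≤ n by omega)
  have hPe4 : Pe ≤ 4 * ((2 : ℝ) ^ g)⁻¹ := by
    have := DecoderData.errorProb_le e c pos hinj hpos hd hdk hdU hU hc₀ hP hq h6 hS
      (hdδ ▸ hδ') hcε hchoose (by rw [hdcap]; exact hover) 0
    change Pe ≤ _ at this
    linarith
  have hPek : Pe ≤ 4 / √k := by
    refine hPe4.trans ?_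
    rw [div_eq_mul_inv]
    refine mul_le_mul_of_nonneg_left (inv_anti₀ (by positivity) ?_) (by norm_num)
    have hk1 : (1 : ℝ) ≤ k := by exact_mod_cast h6
    have h7 : (k : ℝ) ≤ 2 ^ g := by
      -- Since `l + 1 ≤ g`.
      have h8 : n < 2 ^ g :=
        h.lt_two_pow.trans_le (Nat.pow_le_pow_right (by norm_num) (by omega))
      exact_mod_cast (by omega : k ≤ 2 ^ g)
    exact (Real.sqrt_le_left (by positivity)).2 (by nlinarith)
  have htight := htight Pe hPe0 hPe4
  set Θ := tightOrder n k Pe with hΘ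
  have hΘ0 : 0 ≤ Θ := by rw [hΘ, tightOrder]; positivity
  set D := dist (pos (.inl .hub)) (pos (.inl (.sensor s₀))) with hD
  have hD0 : 0 < D := dist_pos.2 fun h => by simpa using hinj h
  have hDR : D ≤ 2 * B * R := by rw [hD, dist_comm]; exact d1 s₀
  -- Just enough padding for `Θ` bit-meters; rounding up costs at most one more bit over a link of
  -- length `D`.
  let pad := ⌈Θ / D⌉₊
  have hpadlow : Θ ≤ pad * D := by
    rw [← div_le_iff₀ hD0]; exact Nat.le_ceil _
  have hpadup : pad * D ≤ Θ + D := by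
    have h8 : (pad : ℝ) ≤ Θ / D + 1 := (Nat.ceil_lt_add_one (by positivity)).le
    calc pad * D ≤ (Θ / D + 1) * D := by gcongr
      _ = Θ + D := by field_simp
  have hlow : ∀ y, Θ ≤ (ckt pad).bitMeters y := fun y =>
    hpadlow.trans ((d.protocol pad).le_bitMeters_circuit e pos hinj hpos s₀ rfl y)
  have hup : ∀ x : Fin n → ℝ, IsSparseVector k U x → (ckt pad).bitMeters (measurement A x)
      ≤ costConstant B (⌊2 * U / δ⌋₊ + 1) * Θ := by
    intro x hx
    have hx' : ∀ j, |x j| ≤ d.U := by rw [hdU]; exact hx.2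
    have hY0 : 0 ≤ d.Y := by rw [hdY]; positivity
    have hmain := (d.protocol pad).bitMeters_circuit_le e pos hinj hpos (by positivity)
      (by positivity) s₀ rfl d1 d2 (fun j => d2' (d.blk j) j (hblk j).symm) d3 d3'
      (measurement A x)
      (fun s => length_report_le hd.η_pos (by
        rw [DecoderData.measurement_sensor, Complex.ofReal_re, hd.Y_eq]
        exact DecoderData.abs_sum_mul_le hd.A_le hx' s) hβ)
      (fun i s => length_report_le hd.η_pos (by
        rw [DecoderData.measurement_probe, Complex.ofReal_re, hd.Y_eq]
        refine DecoderData.abs_sum_mul_le hd.A'_le (fun j => ?_) s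
        split_ifs
        · exact hx' j
        · simpa using hd.U_nonneg) hβ)
      (DecoderData.length_go_le pad) (DecoderData.sum_length_hubOut_le hd pad)
      (DecoderData.sum_length_centreOut_le hd pad)
    rw [hdU, hdδ, hdcap] at hmain
    refine hmain.trans ?_
    have hsum := add_le_add hpadup hcost.1
    refine hsum.trans ?_
    have hD8 := hDR.trans hcost.2
    have hc1 : B * (30000 + 300 * ((⌊2 * U / δ⌋₊ + 1 : ℕ) : ℝ)) * (k * √n / l)
        ≤ B * (30000 + 300 * ((⌊2 * U / δ⌋₊ + 1 : ℕ) : ℝ)) * (3 * Θ) := by gcongr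
    have hc2 : 8 * B * (k * √n / l) ≤ 8 * B * (3 * Θ) := by gcongr
    rw [costConstant]
    linarith
  refine ⟨A, ckt pad, ?_, ?_, ?_, ?_⟩
  · rw [hPe]; exact hPe0
  · rw [hPe]; exact hPek
  · rw [hPe, one_mul]
    -- Integrability matters for the lower bound: the Bochner integral of a non-integrable function
    -- is `0`.
    have hint : Integrable (fun x => (ckt pad).bitMeters (measurement A x)) P := by
      refine Integrable.of_bound (C := costConstant B (⌊2 * U / δ⌋₊ + 1) * Θ)
        ((ckt pad).measurable_bitMeters.comp (measurable_measurement A)).aestronglyMeasurable ?_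
      filter_upwards [hP.ae_sparse] with x hx
      rw [Real.norm_eq_abs, abs_of_nonneg (hΘ0.trans (hlow _))]
      exact hup x hx
    calc Θ = ∫ _x, Θ ∂P := by simp
      _ ≤ _ := integral_mono (integrable_const _) hint fun x => hlow _
  · rw [hPe]; exact hup

/-! ### Asymptotics -/

theorem eventually_two_log_pow_le {r : ℝ} (hr : 0 < r) (s : ℕ) :
    ∀ᶠ n : ℕ in atTop, (2 * Real.log n) ^ s ≤ (n : ℝ) ^ r := by
  have h := (isLittleO_log_rpow_rpow_atTop (s : ℝ) hr).bound
    (show (0 : ℝ) < (2 ^ s)⁻¹ by positivity)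
  filter_upwards [tendsto_natCast_atTop_atTop.eventually h, eventually_ge_atTop 1] with n hn hn1
  have h0 : 0 ≤ Real.log n := Real.log_natCast_nonneg n
  rw [Real.rpow_natCast, Real.norm_of_nonneg (by positivity), Real.norm_of_nonneg (by positivity),
    inv_mul_eq_div, le_div_iff₀ (by positivity)] at hn
  rw [mul_pow, mul_comm]
  exact hn

theorem natLog_two_le_two_mul_log {n : ℕ} (hn : n ≠ 0) : (Nat.log 2 n : ℝ) ≤ 2 * Real.log n := by
  have h1 : ((2 : ℝ) ^ Nat.log 2 n) ≤ n := by exact_mod_cast Nat.pow_log_le_self 2 hn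
  have h2 := Real.log_le_log (by positivity) h1
  rw [Real.log_pow] at h2
  have h3 := Real.log_two_gt_d9
  have h4 : (0 : ℝ) ≤ Nat.log 2 n := Nat.cast_nonneg _
  nlinarith

theorem eventually_le_natLog_two (L : ℕ) : ∀ᶠ n : ℕ in atTop, L ≤ Nat.log 2 n := by
  filter_upwards [eventually_ge_atTop (2 ^ L)] with n hn
  exact Nat.le_log_of_pow_le one_lt_two hn

theorem eventually_regime {β : ℝ} (hβ : β ∈ Set.Ioo (0 : ℝ) 1) :
    ∀ᶠ n : ℕ in atTop, Regime n (sparsity β n) (Nat.log 2 n) := by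
  filter_upwards [eventually_two_log_pow_le (sub_pos.2 hβ.2) 6, eventually_two_log_pow_le hβ.1 4,
    eventually_le_natLog_two 5, eventually_ge_atTop 1] with n h6 h4 h5 hn
  have hl := natLog_two_le_two_mul_log (show n ≠ 0 by omega)
  have hl0 : (0 : ℝ) ≤ Nat.log 2 n := Nat.cast_nonneg _
  have hn0 : (0 : ℝ) < n := by positivity
  refine ⟨h5, Nat.lt_pow_succ_log_self one_lt_two n, ?_, ?_⟩
  · refine Nat.le_floor ?_
    push_cast
    exact (pow_le_pow_left₀ hl0 hl 6).trans h6
  · have hk : (sparsity β n : ℝ) ≤ (n : ℝ) ^ (1 - β) := Nat.floor_le (by positivity)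
    have : ((Nat.log 2 n : ℝ)) ^ 4 * sparsity β n ≤ n := by
      calc _ ≤ (n : ℝ) ^ β * (n : ℝ) ^ (1 - β) :=
            mul_le_mul ((pow_le_pow_left₀ hl0 hl 4).trans h4) hk (by positivity) (by positivity)
        _ = n := by rw [← Real.rpow_add hn0]; simp
    exact_mod_cast this

/-- Half of the exponent `γ k` absorbs `K`, and the other half dominates `2 ^ g` because `g ≤ k / l
≤ γ k / 2`. -/
theorem Regime.mul_exp_le {n k l : ℕ} (h : Regime n k l) {γ K : ℝ} (hγ : 0 < γ)
    (h1 : 2 / γ ≤ l) (h2 : 2 * K / γ ≤ l) :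
    K * Real.exp (-γ * k) ≤ ((2 : ℝ) ^ (k / l))⁻¹ := by
  have hl : (0 : ℝ) < l := by have := h.five_le; positivity
  have hlk : (l : ℝ) ≤ k := by
    have := h.mul_self_le
    have := Nat.le_mul_self l
    exact_mod_cast (by omega : l ≤ k)
  have hgl : ((k / l : ℕ) : ℝ) * l ≤ k := by exact_mod_cast Nat.div_mul_le_self k l
  rw [div_le_iff₀ hγ] at h1 h2
  have hg : ((k / l : ℕ) : ℝ) ≤ γ * k / 2 := by
    have hg0 : (0 : ℝ) ≤ ((k / l : ℕ) : ℝ) := Nat.cast_nonneg _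
    have := mul_le_mul_of_nonneg_left h1 hg0
    nlinarith
  have hK : K ≤ Real.exp (γ * k / 2) := by
    have := Real.add_one_le_exp (γ * k / 2)
    have := mul_le_mul_of_nonneg_left hlk hγ.le
    linarith
  have h2g : (2 : ℝ) ^ (k / l) ≤ Real.exp (γ * k / 2) := by
    calc (2 : ℝ) ^ (k / l) ≤ Real.exp 1 ^ (k / l) := by
          gcongr
          have := Real.add_one_le_exp (1 : ℝ)
          linarith
      _ = Real.exp ((k / l : ℕ) : ℝ) := by rw [← Real.exp_nat_mul, mul_one]
      _ ≤ _ := Real.exp_le_exp.2 hg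
  calc K * Real.exp (-γ * k) ≤ Real.exp (γ * k / 2) * Real.exp (-γ * k) := by gcongr
    _ = (Real.exp (γ * k / 2))⁻¹ := by rw [← Real.exp_add, ← Real.exp_neg]; congr 1; ring
    _ ≤ _ := inv_anti₀ (by positivity) h2g

theorem nonempty_decodingCircuit (Λ : Submodule ℤ Plane) [DiscreteTopology Λ] [IsZLattice ℝ Λ]
    (m n : ℕ) : Nonempty (DecodingCircuit Λ m n) := by
  obtain ⟨φ, -, -, hφ, hΛ, -⟩ := exists_lattice_embedding Λ
  let ι : Node m n → ℤ × ℤ := fun u => (((Fintype.equivFin (Node m n) u : ℕ) : ℤ), 0)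
  have hι : Function.Injective ι := fun u v h => by
    simp only [ι, Prod.mk.injEq, Nat.cast_inj, and_true] at h
    exact (Fintype.equivFin _).injective (Fin.ext h)
  exact ⟨{
    substrate := Set.range (φ ∘ ι)
    isCompact_substrate := (Set.finite_range _).isCompact
    pos := φ ∘ ι
    pos_injective := hφ.comp hι
    pos_mem := fun u => ⟨hΛ _, Set.mem_range_self u⟩
    rounds := 0
    slot := fun _ _ => 0
    rule := fun _ _ _ _ => []
    rule_self := fun _ _ _ => rfl
    measurableSet_rule := fun _ _ _ _ => MeasurableSet.const _
    out := fun _ _ => 0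
    out_silent := fun _ => rfl }⟩

end

/-! ### Conclusion -/

theorem corollary2 (β : ℝ) (hβ : β ∈ Set.Ioo (0 : ℝ) 1)
    (ρ : ℝ) (hρ : 0 < ρ) (Λ : Submodule ℤ Plane) [DiscreteTopology Λ] [IsZLattice ℝ Λ]
    (hΛ : ρ ≤ packingRadius Λ)
    (U : ℝ) (hU : 0 < U) (q : ℝ≥0∞) (hq : q ≠ 0) (Q : ℕ) (hQ : 0 < Q)
    (c₀ γ K : ℝ) (hc₀ : 0 < c₀) (hγ : 0 < γ) :
    ∃ M₀ : ℝ, 0 < M₀ ∧ ∀ M₁ : ℝ, ∃ c C D : ℝ, 0 < c ∧ 0 < C ∧ 0 < D ∧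
      ∀ m : ℕ → ℕ,
        (∀ᶠ n in atTop, M₀ * sparsity β n ≤ m n ∧ (m n : ℝ) ≤ M₁ * sparsity β n) →
      ∀ P : (n : ℕ) → Measure (Fin n → ℝ),
        (∀ n, IsSparseSource (sparsity β n) U (P n)) →
        (∀ᶠ n in atTop,
          (P n).real {x | lqNorm q x < c₀ * (sparsity β n : ℝ) ^ (1 / q.toReal) * U}
            ≤ K * Real.exp (-γ * sparsity β n)) →
      ∃ (A : (n : ℕ) → Matrix (Fin (m n)) (Fin n) ℂ)
        (ckt : (n : ℕ) → DecodingCircuit Λ (m n) n),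
        ∀ᶠ n in atTop,
          0 < (ckt n).errorProb (A n) q Q (P n) ∧
          (ckt n).errorProb (A n) q Q (P n) ≤ D / √(sparsity β n) ∧
          c * tightOrder n (sparsity β n) ((ckt n).errorProb (A n) q Q (P n))
            ≤ ∫ x, (ckt n).bitMeters (measurement (A n) x) ∂(P n) ∧
          ∀ x : Fin n → ℝ, IsSparseVector (sparsity β n) U x →
            (ckt n).bitMeters (measurement (A n) x)
              ≤ C * tightOrder n (sparsity β n) ((ckt n).errorProb (A n) q Q (P n)) := by
  obtain ⟨B, hB, hlay⟩ := exists_hasLayouts Λ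
  -- The decoder is accurate to `3 δ` per entry, so this is the coarsest step that meets the
  -- precision.
  set δ : ℝ := ((2 : ℝ) ^ Q)⁻¹ * (c₀ * U) / 3 with hδ
  have hδ0 : 0 < δ := by positivity
  have hδ' : 3 * δ ≤ ((2 : ℝ) ^ Q)⁻¹ * (c₀ * U) := by rw [hδ]; linarith
  refine ⟨400, by norm_num, fun M₁ => ⟨1, costConstant B (⌊2 * U / δ⌋₊ + 1), 4, one_pos, ?_,
    by norm_num, fun m hm P hP hsmall => ?_⟩⟩
  · rw [costConstant]; positivity
  -- A matrix and a circuit are needed for every `n`; outside the regime a silent circuit fills the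
  -- gap.
  have key : ∀ n, ∃ (A : Matrix (Fin (m n)) (Fin n) ℂ) (ckt : DecodingCircuit Λ (m n) n),
      (Regime n (sparsity β n) (Nat.log 2 n) ∧ 420 * U / δ ≤ n ∧ 400 * sparsity β n ≤ m n ∧
        (P n).real {x | lqNorm q x < c₀ * (sparsity β n : ℝ) ^ (1 / q.toReal) * U}
          ≤ ((2 : ℝ) ^ (sparsity β n / Nat.log 2 n))⁻¹) →
      0 < ckt.errorProb A q Q (P n) ∧ ckt.errorProb A q Q (P n) ≤ 4 / √(sparsity β n) ∧
      1 * tightOrder n (sparsity β n) (ckt.errorProb A q Q (P n))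
        ≤ ∫ x, ckt.bitMeters (measurement A x) ∂(P n) ∧
      ∀ x : Fin n → ℝ, IsSparseVector (sparsity β n) U x → ckt.bitMeters (measurement A x)
        ≤ costConstant B (⌊2 * U / δ⌋₊ + 1)
          * tightOrder n (sparsity β n) (ckt.errorProb A q Q (P n)) := by
    intro n
    by_cases h : Regime n (sparsity β n) (Nat.log 2 n) ∧ 420 * U / δ ≤ n ∧
        400 * sparsity β n ≤ m n ∧
        (P n).real {x | lqNorm q x < c₀ * (sparsity β n : ℝ) ^ (1 / q.toReal) * U}
          ≤ ((2 : ℝ) ^ (sparsity β n / Nat.log 2 n))⁻¹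
    · obtain ⟨A, ckt, hA⟩ := h.1.exists_circuit hB hlay hU hc₀ hq hQ hδ0 hδ' h.2.1 h.2.2.1
        (hP n) h.2.2.2
      exact ⟨A, ckt, fun _ => hA⟩
    · obtain ⟨ckt⟩ := nonempty_decodingCircuit Λ (m n) n
      exact ⟨0, ckt, fun h' => absurd h' h⟩
  choose A ckt hA using key
  refine ⟨A, ckt, ?_⟩
  filter_upwards [hm, hsmall, eventually_regime hβ, eventually_ge_atTop ⌈420 * U / δ⌉₊,
    eventually_le_natLog_two ⌈2 / γ⌉₊, eventually_le_natLog_two ⌈2 * K / γ⌉₊]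
    with n hmn hsn hreg hn hl1 hl2
  refine hA n ⟨hreg, Nat.ceil_le.1 hn, by exact_mod_cast hmn.1, hsn.trans ?_⟩
  exact hreg.mul_exp_le hγ (Nat.ceil_le.1 hl1) (Nat.ceil_le.1 hl2)
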